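/- Let $X$ be a non-empty compact Hausdorff space and let $\mathcal A\to X$ be a unital (F) $C^*$-bundle with non-zero fibers. That is: each fiber $\mathcal A_x$ is a non-zero unital complex $C^*$-algebra; the total space $\mathcal A$ is topologized so that the projection $\pi$ to $X$ is continuous and open; addition and multiplication on $\mathcal A\times_X\mathcal A$, scalar multiplication on $\mathbb C\times\mathcal A$, the involution, the norm, and the unit section $x\mapsto 1_{\mathcal A_x}$ are continuous; and the sets $\{p:\pi(p)\in V,\ \|p\|<\varepsilon\}$ ($V$ a neighborhood of $x$, $\varepsilon>0$) form a neighborhood basis at $0_x$. Suppose that $\mathcal A$ is subhomogeneous: $\sup_x\dim\mathcal A_x<\infty$. Let $\Gamma(\mathcal A)$ be the $C^*$-algebra of continuous sections, with the supremum norm, and embed $C(X)\hookrightarrow\Gamma(\mathcal A)$ by $f\mapsto (x\mapsto f(x)1_{\mathcal A_x})$. *Rank.* For a finite-dimensional $C^*$-algebra $B$ let $r(B)$ be the sum of the dimensions of its irreducible $*$-representations up to unitary equivalence; put $r(\mathcal A)=\sup_x r(\mathcal A_x)$ and $U_{\max}=\{x\in X: r(\mathcal A_x)=r(\mathcal A)\}$.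 *Optimal expectations.* A conditional expectation $E:\Gamma(\mathcal A)\to C(X)$ is an idempotent linear map of norm $1$ from $\Gamma(\mathcal A)$ to itself with range $C(X)$, and $K(E)=\inf\{K\ge 1: K\cdot E-\mathrm{id}\text{ is a positive map}\}\in[1,\infty]$. It is optimal if $K(E)=r(\mathcal A)$. *Germs of column-sum tuples.* For ${\bf n}=(n_1,\dots,n_k)\in\mathbb Z_{>0}^k$ let $M_{\bf n}=M_{n_1}(\mathbb C)\times\cdots\times M_{n_k}(\mathbb C)$. The Bratteli matrix of a unital $*$-homomorphism $\iota:M_{\bf m}\to M_{\bf n}$ has entries $T_{ij}=\mathrm{Tr}_i(\iota(p_j))$, where $p_j$ is a minimal projection in the $j$-th factor of $M_{\bf m}$ and $\mathrm{Tr}_i$ is the un-normalized trace of the $i$-th factor of $M_{\bf n}$; its column-sum tuple is $(\sum_i T_{ij})_j$. For a unital $*$-homomorphism $M_{\bf m}\to B$ into a finite-dimensional $C^*$-algebra $B$, the column-sum tuple is computed after any identification $B\cong M_{\bf n}$, and does not depend on that identification. A local extension of the fiber $\mathcal A_x$ consists of a neighborhood $U$ of $x$ and unital injective $*$-homomorphisms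 $\varphi_y:\mathcal A_x\to\mathcal A_y$ ($y\in U$) such that $\varphi_x=\mathrm{id}$ and $y\mapsto\varphi_y(a)$ is continuous on $U$ for every $a\in\mathcal A_x$ (a trivialized homogeneous $C^*$-bundle $\mathcal B_y=\varphi_y(\mathcal A_x)\le\mathcal A_y$ over $U$ that extends the fiber $\mathcal A_x$). Given an identification $\psi:M_{\bf m}\cong\mathcal A_x$, which labels the columns by the simple summands of $\mathcal A_x$, a tuple $c=(c_j)_j$ is a germ of column-sum tuples at $x$ if for some local extension $(U,(\varphi_y)_y)$ of $\mathcal A_x$ every neighborhood of $x$ contains a point $y\in U\cap U_{\max}$ such that $c$ is the column-sum tuple of $\varphi_y\circ\psi:M_{\bf m}\to\mathcal A_y$. **Proposition.** The set $U_{\max}$ is open. If $U_{\max}$ is dense in $X$, then the following are equivalent: 1. there is an optimal expectation $E:\Gamma(\mathcal A)\to C(X)$, i.e. one with $K(E)=r(\mathcal A)$; 2. $\mathcal A$ has unique germs of column-sum tuples at every point: for every $x\in X$ and every identification $\psi:M_{\bf m}\cong\mathcal A_x$ there is exactly one germ of column-sum tuples at $x$. -/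

import Mathlib

open Bundle Filter Topology
open scoped ENNReal NNReal

noncomputable section

/-! ### Continuous (F) bundles of unital C*-algebras -/

/-- The total space of a family of fibres (the model fibre in Mathlib's `Bundle.TotalSpace` is a
phantom argument, not used here). -/
abbrev Tot {X : Type*} (A : X → Type*) := TotalSpace Unit A

/-- The fibre product of the total space with itself over the base; it carries the topology of a
subspace of `Tot A × Tot A`. -/
abbrev FibreSquare {X : Type*} (A : X → Type*) := TotalSpace (Unit × Unit) (A ×ᵇ A)

/-- A topology on the total space of a family of unital C*-algebras over `X` makes it a unital
continuous (F) C*-bundle: the projection is continuous and open; the operations, the unit and the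
norm are continuous; and the sets `{p | π p ∈ V, ‖p‖ < ε}`, for neighbourhoods `V` of `x` and
`ε > 0`, are a neighbourhood basis at the zero element of the fibre at `x`. -/
class IsUnitalFCStarBundle {X : Type*} [TopologicalSpace X] (A : X → Type*)
    [∀ x, CStarAlgebra (A x)] [TopologicalSpace (Tot A)] : Prop where
  continuous_proj : Continuous (fun p : Tot A => p.proj)
  isOpenMap_proj : IsOpenMap (fun p : Tot A => p.proj)
  continuous_add : Continuous
    (fun p : FibreSquare A => (⟨p.proj, p.snd.1 + p.snd.2⟩ : Tot A))
  continuous_smul : Continuous (fun p : ℂ × Tot A => (⟨p.2.proj, p.1 • p.2.snd⟩ : Tot A))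
  continuous_mul : Continuous
    (fun p : FibreSquare A => (⟨p.proj, p.snd.1 * p.snd.2⟩ : Tot A))
  continuous_star : Continuous (fun p : Tot A => (⟨p.proj, star p.snd⟩ : Tot A))
  continuous_one : Continuous (fun x : X => (⟨x, 1⟩ : Tot A))
  continuous_norm : Continuous (fun p : Tot A => ‖p.snd‖)
  hasBasis_nhds_zero : ∀ x : X, (𝓝 (⟨x, 0⟩ : Tot A)).HasBasis
    (fun Vε : Set X × ℝ => Vε.1 ∈ 𝓝 x ∧ 0 < Vε.2)
    (fun Vε => {p : Tot A | p.proj ∈ Vε.1 ∧ ‖p.snd‖ < Vε.2})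

/-- The dimensions of the fibres are finite and bounded. -/
def IsSubhomogeneous {X : Type*} (A : X → Type*) [∀ x, CStarAlgebra (A x)] : Prop :=
  ∃ N : ℕ, ∀ x, FiniteDimensional ℂ (A x) ∧ Module.finrank ℂ (A x) ≤ N

/-! ### The C*-algebra of continuous sections -/

section Sections

variable {X : Type*} [TopologicalSpace X] (A : X → Type*) [∀ x, CStarAlgebra (A x)]

instance lpInftyCStarAlgebra [∀ x, Nontrivial (A x)] : CStarAlgebra (lp A ∞) where

variable [TopologicalSpace (Tot A)] [hA : IsUnitalFCStarBundle A]

variable {A} in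
theorem continuous_section_add {s t : ∀ x, A x} (hs : Continuous fun x => (⟨x, s x⟩ : Tot A))
    (ht : Continuous fun x => (⟨x, t x⟩ : Tot A)) :
    Continuous fun x => (⟨x, s x + t x⟩ : Tot A) := by
  have h : Continuous fun x => (⟨x, (s x, t x)⟩ : FibreSquare A) :=
    continuous_induced_rng.2 (hs.prodMk ht)
  exact hA.continuous_add.comp h

variable {A} in
theorem continuous_section_mul {s t : ∀ x, A x} (hs : Continuous fun x => (⟨x, s x⟩ : Tot A))
    (ht : Continuous fun x => (⟨x, t x⟩ : Tot A)) :
    Continuous fun x => (⟨x, s x * t x⟩ : Tot A) := by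
  have h : Continuous fun x => (⟨x, (s x, t x)⟩ : FibreSquare A) :=
    continuous_induced_rng.2 (hs.prodMk ht)
  exact hA.continuous_mul.comp h

variable {A} in
theorem continuous_section_smul {f : X → ℂ} {s : ∀ x, A x} (hf : Continuous f)
    (hs : Continuous fun x => (⟨x, s x⟩ : Tot A)) :
    Continuous fun x => (⟨x, f x • s x⟩ : Tot A) :=
  hA.continuous_smul.comp (hf.prodMk hs)

theorem continuous_section_scalar {f : X → ℂ} (hf : Continuous f) :
    Continuous fun x => (⟨x, f x • 1⟩ : Tot A) :=
  continuous_section_smul hf hA.continuous_one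

variable {A} in
theorem exists_add_mem {x : X} (p : A x) {W : Set (Tot A)} (hW : W ∈ 𝓝 (⟨x, p⟩ : Tot A)) :
    ∃ ε > 0, ∃ V ∈ 𝓝 x, ∃ W' ∈ 𝓝 (⟨x, p⟩ : Tot A), ∀ y ∈ V, ∀ a b : A y, ‖a‖ < ε →
      (⟨y, b⟩ : Tot A) ∈ W' → (⟨y, a + b⟩ : Tot A) ∈ W := by
  have h0 : W ∈ 𝓝 (⟨x, 0 + p⟩ : Tot A) := by rwa [zero_add]
  have h1 := hA.continuous_add.continuousAt (x := (⟨x, (0, p)⟩ : FibreSquare A)) h0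
  rw [Filter.mem_map, mem_nhds_induced] at h1
  obtain ⟨S, hS, hSW⟩ := h1
  rw [mem_nhds_prod_iff] at hS
  obtain ⟨N, hN, W', hW', hNW⟩ := hS
  obtain ⟨⟨V, ε⟩, ⟨hV, hε⟩, hVN⟩ := (hA.hasBasis_nhds_zero x).mem_iff.1 hN
  refine ⟨ε, hε, V, hV, W', hW', fun y hy a b ha hb => ?_⟩
  have hab : ((⟨y, a⟩, ⟨y, b⟩) : Tot A × Tot A) ∈ S := hNW ⟨hVN ⟨hy, ha⟩, hb⟩
  exact @hSW (⟨y, (a, b)⟩ : FibreSquare A) hab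

variable [∀ x, Nontrivial (A x)]

/-- The bounded continuous sections, inside the C*-algebra of all bounded sections with the
supremum norm. Over a compact base every continuous section is bounded. -/
def sectionSubalgebra : StarSubalgebra ℂ (lp A ∞) where
  carrier := {s | Continuous fun x => (⟨x, s x⟩ : Tot A)}
  add_mem' hs ht := continuous_section_add hs ht
  mul_mem' hs ht := continuous_section_mul hs ht
  algebraMap_mem' c := by
    have h : ∀ x, (algebraMap ℂ (lp A ∞) c) x = c • (1 : A x) := fun x =>
      Algebra.algebraMap_eq_smul_one c
    simpa only [Set.mem_ofPred_eq, h] using continuous_section_scalar A continuous_const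
  star_mem' hs := hA.continuous_star.comp hs

/-- Uniform limits of continuous sections are continuous. -/
instance isClosed_sectionSubalgebra : IsClosed (sectionSubalgebra A : Set (lp A ∞)) := by
  refine isClosed_of_closure_subset fun s hs => ?_
  change Continuous fun x => (⟨x, s x⟩ : Tot A)
  refine continuous_iff_continuousAt.2 fun x W hW => ?_
  obtain ⟨ε, hε, V, hV, W', hW', h⟩ := exists_add_mem (s x) hW
  obtain ⟨ε', hε', V', hV', W'', hW'', h'⟩ := exists_add_mem (s x) (interior_mem_nhds.2 hW')
  obtain ⟨t, ht, hst⟩ := Metric.mem_closure_iff.1 hs (min ε ε') (lt_min hε hε')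
  have hst' : ‖s - t‖ < min ε ε' := by rwa [dist_eq_norm] at hst
  have key : ∀ y, ‖s y - t y‖ < min ε ε' := fun y =>
    (lp.norm_apply_le_norm ENNReal.top_ne_zero (s - t) y).trans_lt hst'
  have htx : (⟨x, t x⟩ : Tot A) ∈ interior W' := by
    have := h' x (mem_of_mem_nhds hV') (t x - s x) (s x)
      (by rw [norm_sub_rev]; exact (key x).trans_le (min_le_right _ _)) (mem_of_mem_nhds hW'')
    rwa [sub_add_cancel] at this
  have ht' : Continuous fun y => (⟨y, t y⟩ : Tot A) := ht
  have hev : ∀ᶠ y in 𝓝 x, (⟨y, t y⟩ : Tot A) ∈ interior W' :=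
    ht'.continuousAt (isOpen_interior.mem_nhds htx)
  refine Filter.mem_map.2 ?_
  filter_upwards [hev, hV] with y hy hyV
  have := h y hyV (s y - t y) (t y) ((key y).trans_le (min_le_left _ _)) (interior_subset hy)
  rwa [sub_add_cancel] at this

/-- The C*-algebra `Γ(A)` of continuous sections. -/
abbrev Sections := sectionSubalgebra A

/-- The order on `Γ(A)`: the positive elements are those of the form `star b * b`. -/
instance sectionsPartialOrder : PartialOrder (Sections A) := CStarAlgebra.spectralOrder _

instance sectionsStarOrderedRing : StarOrderedRing (Sections A) :=
  CStarAlgebra.spectralOrderedRing _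

variable [CompactSpace X]

/-- The embedding of `C(X)` into `Γ(A)`, sending `f` to the section `x ↦ f x • 1`. -/
def scalarSection (f : C(X, ℂ)) : Sections A :=
  ⟨⟨fun x => f x • (1 : A x), memℓp_infty ⟨‖f‖, by
      rintro _ ⟨x, rfl⟩
      simpa [norm_smul] using f.norm_coe_le_norm x⟩⟩,
    continuous_section_scalar A f.continuous⟩

end Sections

/-! ### Conditional expectations and their `K`-constants -/

/-- A conditional expectation of a C*-algebra onto a subset `B` (in practice a C*-subalgebra): an
idempotent linear map of norm one with range `B`. -/
structure IsConditionalExpectation {C : Type*} [CStarAlgebra C] (B : Set C) (E : C →L[ℂ] C) :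
    Prop where
  idempotent : ∀ a, E (E a) = E a
  range_eq : Set.range E = B
  norm_eq_one : ‖E‖ = 1

/-- `K(E) = inf {K ≥ 1 | K • E - id is a positive map}`, with value `∞` if there is no such `K`. -/
def kConstant {C : Type*} [CStarAlgebra C] [PartialOrder C] [StarOrderedRing C] (E : C →L[ℂ] C) :
    ℝ≥0∞ :=
  ⨅ (K : ℝ≥0) (_ : 1 ≤ K) (_ : ∀ a : C, 0 ≤ a → 0 ≤ (K : ℝ) • E a - a), (K : ℝ≥0∞)

/-! ### Irreducible representations and the rank -/

/-- A finite-dimensional irreducible (unital) *-representation, on `ℂ ^ dim`. -/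
structure IrrepFD (B : Type*) [CStarAlgebra B] where
  dim : ℕ
  dim_pos : 0 < dim
  rep : B →⋆ₐ[ℂ] Matrix (Fin dim) (Fin dim) ℂ
  irreducible : ∀ W : Submodule ℂ (Fin dim → ℂ),
    (∀ b, ∀ w ∈ W, (rep b).mulVec w ∈ W) → W = ⊥ ∨ W = ⊤

/-- Unitary equivalence of representations. -/
def IrrepFD.Equivalent {B : Type*} [CStarAlgebra B] (σ τ : IrrepFD B) : Prop :=
  ∃ u : Matrix (Fin σ.dim) (Fin τ.dim) ℂ, u * u.conjTranspose = 1 ∧ u.conjTranspose * u = 1 ∧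
    ∀ b, u * τ.rep b = σ.rep b * u

/-- The sum of the dimensions of the irreducible representations of a finite-dimensional
C*-algebra, up to unitary equivalence: the supremum of the sums over finite sets of mutually
inequivalent irreducible representations. -/
def cstarRank (B : Type*) [CStarAlgebra B] : ℕ∞ :=
  ⨆ (s : Finset (IrrepFD B)) (_ : (s : Set (IrrepFD B)).Pairwise fun σ τ => ¬ σ.Equivalent τ),
    ∑ σ ∈ s, (σ.dim : ℕ∞)

/-- The rank `r(A)` of a bundle. -/
def bundleRank {X : Type*} (A : X → Type*) [∀ x, CStarAlgebra (A x)] : ℕ∞ :=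
  ⨆ x, cstarRank (A x)

/-- The points at which the rank of the fibre is the rank of the bundle. -/
def maxRankLocus {X : Type*} (A : X → Type*) [∀ x, CStarAlgebra (A x)] : Set X :=
  {x | cstarRank (A x) = bundleRank A}

/-! ### Bratteli matrices and germs of column-sum tuples -/

/-- The multi-matrix algebra `M_{n 1} × ⋯ × M_{n k}`. -/
abbrev MultiMatrix {k : ℕ} (n : Fin k → ℕ+) := ∀ i, Matrix (Fin (n i)) (Fin (n i)) ℂ

/-- The matrix unit `e₁₁` of the `j`-th factor, a minimal projection in that factor. -/
def minimalProjection {k : ℕ} (m : Fin k → ℕ+) (j : Fin k) : MultiMatrix m :=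
  Pi.single j (Matrix.single ⟨0, (m j).pos⟩ ⟨0, (m j).pos⟩ 1)

/-- The Bratteli matrix of a unital *-homomorphism of multi-matrix algebras: the entry `T i j` is
the un-normalized trace, in the `i`-th factor of the target, of the image of a minimal projection
in the `j`-th factor of the source (a natural number). -/
def bratteliMatrix {k l : ℕ} {m : Fin k → ℕ+} {n : Fin l → ℕ+}
    (ι : MultiMatrix m →⋆ₐ[ℂ] MultiMatrix n) : Matrix (Fin l) (Fin k) ℂ :=
  fun i j => (ι (minimalProjection m j) i).trace

section Germs

variable {X : Type*} [TopologicalSpace X] (A : X → Type*) [∀ x, CStarAlgebra (A x)]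
  [TopologicalSpace (Tot A)]

/-- An extension of the fibre at `x` to a homogeneous C*-bundle `B`, with fibres `B y ≤ A y`, over
a neighbourhood `U` of `x`. As homogeneous bundles of finite-dimensional C*-algebras are locally
trivial, `B` is given with a trivialization: unital embeddings of the fibre at `x` into the fibres
over `U`, with images `B y`, which depend continuously on `y` and are the identity at `x`. -/
structure LocalExtension (x : X) where
  U : Set X
  mem_nhds : U ∈ 𝓝 x
  hom : ∀ y : U, A x →⋆ₐ[ℂ] A y
  injective : ∀ y, Function.Injective (hom y)
  hom_self : ∀ a, hom ⟨x, mem_of_mem_nhds mem_nhds⟩ a = a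
  continuous : ∀ a, Continuous fun y : U => (⟨y, hom y a⟩ : Tot A)

variable {A}

/-- `c` is the tuple of column sums of the Bratteli matrix of an embedding of the multi-matrix
algebra `M_m` into a finite-dimensional C*-algebra `B`, with respect to some identification of `B`
with a multi-matrix algebra. (The column sums do not depend on the identification.) -/
def IsColumnSumTuple {B : Type*} [CStarAlgebra B] {k : ℕ} {m : Fin k → ℕ+}
    (ι : MultiMatrix m →⋆ₐ[ℂ] B) (c : Fin k → ℂ) : Prop :=
  ∃ (l : ℕ) (n : Fin l → ℕ+) (χ : B ≃⋆ₐ[ℂ] MultiMatrix n),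
    ∀ j, ∑ i, bratteliMatrix ((χ : B →⋆ₐ[ℂ] MultiMatrix n).comp ι) i j = c j

/-- `c` is a germ at `x` of column-sum tuples, the columns being labelled by the factors of the
fibre at `x` through an identification `ψ` of it with a multi-matrix algebra: for some extension of
the fibre at `x`, the tuple `c` is attained by the embeddings into the fibres at points of maximal
rank arbitrarily close to `x`. -/
def IsColumnSumGerm {x : X} {k : ℕ} {m : Fin k → ℕ+} (ψ : MultiMatrix m ≃⋆ₐ[ℂ] A x)
    (c : Fin k → ℂ) : Prop :=
  ∃ B : LocalExtension A x, ∀ V ∈ 𝓝 x, ∃ y : B.U, (y : X) ∈ V ∧ (y : X) ∈ maxRankLocus A ∧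
    IsColumnSumTuple ((B.hom y).comp (ψ : MultiMatrix m →⋆ₐ[ℂ] A x)) c

end Germs

end

/-! Write `R` for the rank of the bundle and Tr for the sum of the un-normalized traces of the
simple summands of a fibre (`fdTrace`). The column sums of an embedding are the values of Tr at the
images of minimal projections, while an optimal expectation has to be Tr / `R` over the points of
maximal rank. When these points are dense, both conditions say that Tr, defined over them, extends
continuously to all of `X`.

The rigidity is in `eq_traceSum`: on an algebra of rank `R`, a functional with value `R` at the unit
and at least 1 on nonzero projections is Tr, because the unit is a sum of `R` minimal projections
and there is no slack. If K(E) = `R` and `y` has maximal rank, then E followed by evaluation at `y`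
factors through the fibre, and `R` times the resulting state is such a functional
(`exists_functional_of_optimal`). So Tr of a section agrees over the maximal locus with a continuous
function on `X`, whose value at `x` is the only possible germ (`isColumnSumGerm_eq_of_functional`).
A germ exists because column-sum tuples take finitely many values (`exists_isColumnSumGerm`).

Conversely, finiteness and uniqueness force the tuple of a suitable local extension to be constant
along the maximal locus near `x`, so Tr has a limit functional on the fibre at `x`
(`exists_limit_functional`). These functionals vary continuously along sections
(`continuous_limit_functional`) and, divided by `R`, define E. Then K(E) ≤ `R` because Tr of a
positive element dominates its norm, and K(E) ≥ `R` by testing on a projection of trace one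
(`exists_optimal_expectation`).

All this needs enough sections and local extensions. Approximately continuous sections are glued and
improved until every point of the total space lies on a continuous section
(`exists_section_apply_eq`). Functional calculus in the algebra of sections then lifts the matrix
units of a fibre to nearby fibres (`nonempty_localExtension`). As unital embeddings do not lower the
rank, the maximal locus is open (`isOpen_maxRankLocus`). -/

noncomputable section

/-! ### Multi-matrix algebras -/

section MultiMatrix

open scoped ComplexOrder

variable {k : ℕ} {n : Fin k → ℕ+}

/-- The matrix unit `e_{ab}` of the `i`-th factor. -/
def matrixUnit (n : Fin k → ℕ+) (i : Fin k) (a b : Fin (n i)) : MultiMatrix n :=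
  Pi.single i (Matrix.single a b 1)

theorem minimalProjection_eq (j : Fin k) :
    minimalProjection n j = matrixUnit n j ⟨0, (n j).pos⟩ ⟨0, (n j).pos⟩ := rfl

theorem matrixUnit_mul_matrixUnit (i : Fin k) (a b c : Fin (n i)) :
    matrixUnit n i a b * matrixUnit n i b c = matrixUnit n i a c := by
  rw [matrixUnit, matrixUnit, ← Pi.single_mul]
  simp [matrixUnit]

theorem matrixUnit_mul_matrixUnit_of_ne (i : Fin k) (a : Fin (n i)) {b b' : Fin (n i)}
    (c : Fin (n i)) (h : b ≠ b') : matrixUnit n i a b * matrixUnit n i b' c = 0 := by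
  rw [matrixUnit, matrixUnit, ← Pi.single_mul]
  simp [h]

theorem matrixUnit_mul_matrixUnit_of_ne_factor {i j : Fin k} (h : i ≠ j) (a b : Fin (n i))
    (c d : Fin (n j)) : matrixUnit n i a b * matrixUnit n j c d = 0 := by
  funext l
  by_cases hl : l = i
  · subst hl
    simp [matrixUnit, Pi.single_eq_of_ne h]
  · simp [matrixUnit, Pi.single_eq_of_ne hl]

theorem star_matrixUnit (i : Fin k) (a b : Fin (n i)) :
    star (matrixUnit n i a b) = matrixUnit n i b a := by
  rw [matrixUnit, ← Pi.single_star]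
  simp [matrixUnit, Matrix.star_eq_conjTranspose]

theorem matrixUnit_ne_zero (i : Fin k) (a b : Fin (n i)) : matrixUnit n i a b ≠ 0 := by
  intro h
  have := congrFun (congrFun (congrFun h i) a) b
  simp [matrixUnit] at this

theorem isStarProjection_matrixUnit (i : Fin k) (a : Fin (n i)) :
    IsStarProjection (matrixUnit n i a a) :=
  ⟨matrixUnit_mul_matrixUnit i a a a, star_matrixUnit i a a⟩

theorem MultiMatrix.eq_sum_matrixUnit (x : MultiMatrix n) :
    x = ∑ i, ∑ a, ∑ b, x i a b • matrixUnit n i a b := by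
  funext i
  rw [Finset.sum_apply, Finset.sum_eq_single i]
  · conv_lhs => rw [Matrix.matrix_eq_sum_single (x i)]
    simp [matrixUnit, Finset.sum_apply]
  · intro j _ hj
    simp [matrixUnit, Finset.sum_apply, Pi.single_eq_of_ne hj.symm]
  · simp

theorem MultiMatrix.linearMap_ext {V : Type*} [AddCommMonoid V] [Module ℂ V]
    {f g : MultiMatrix n →ₗ[ℂ] V}
    (h : ∀ i a b, f (matrixUnit n i a b) = g (matrixUnit n i a b)) : f = g := by
  refine LinearMap.ext fun x => ?_
  rw [MultiMatrix.eq_sum_matrixUnit x]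
  simp only [map_sum, map_smul, h]

theorem sum_matrixUnit_self : ∑ i, ∑ a, matrixUnit n i a a = 1 := by
  conv_rhs => rw [MultiMatrix.eq_sum_matrixUnit (1 : MultiMatrix n)]
  refine Finset.sum_congr rfl fun i _ => Finset.sum_congr rfl fun a _ => ?_
  rw [Finset.sum_eq_single a] <;> simp +contextual [eq_comm]

theorem matrixUnit_conj (i : Fin k) (a b : Fin (n i)) (x : MultiMatrix n) :
    matrixUnit n i a a * x * matrixUnit n i b b = x i a b • matrixUnit n i a b := by
  funext j
  by_cases hj : j = i
  · subst hj
    simp [matrixUnit]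
  · simp [matrixUnit, Pi.single_eq_of_ne hj]

/-- The sum of the un-normalized traces of the factors. -/
def traceSum (n : Fin k → ℕ+) : MultiMatrix n →ₗ[ℂ] ℂ :=
  ∑ i, Matrix.traceLinearMap (Fin (n i)) ℂ ℂ ∘ₗ LinearMap.proj i

theorem traceSum_apply (x : MultiMatrix n) : traceSum n x = ∑ i, (x i).trace := by
  simp [traceSum, LinearMap.sum_apply]

theorem traceSum_one : traceSum n 1 = ((∑ i, (n i : ℕ) : ℕ) : ℂ) := by
  simp [traceSum_apply, Matrix.trace_one]

theorem traceSum_mul_comm (x y : MultiMatrix n) : traceSum n (x * y) = traceSum n (y * x) := by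
  simp only [traceSum_apply, Pi.mul_apply]
  exact Finset.sum_congr rfl fun i _ => Matrix.trace_mul_comm _ _

theorem traceSum_matrixUnit (i : Fin k) (a b : Fin (n i)) :
    traceSum n (matrixUnit n i a b) = if a = b then 1 else 0 := by
  rw [traceSum_apply, Finset.sum_eq_single i]
  · split_ifs with h
    · subst h; simp [matrixUnit]
    · simp [matrixUnit, h]
  · intro j _ hj
    simp [matrixUnit, Pi.single_eq_of_ne hj]
  · simp

/-- The trace of an idempotent is the dimension of its range. This integrality later confines column
sums to a finite set. -/
theorem Matrix.exists_trace_eq_natCast_of_isIdempotentElem {d : ℕ} {p : Matrix (Fin d) (Fin d) ℂ}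
    (hp : IsIdempotentElem p) : ∃ r : ℕ, p.trace = r ∧ (p ≠ 0 → 1 ≤ r) := by
  have hp' : IsIdempotentElem (Matrix.toLin' p) := by
    rw [IsIdempotentElem, Module.End.mul_eq_comp, ← Matrix.toLin'_mul, hp.eq]
  refine ⟨Module.finrank ℂ (LinearMap.range (Matrix.toLin' p)), ?_, fun h => ?_⟩
  · rw [← (LinearMap.IsIdempotentElem.isProj_range _ hp').trace, Matrix.trace_toLin'_eq]
  · rw [Nat.one_le_iff_ne_zero, Ne, Submodule.finrank_eq_zero, LinearMap.range_eq_bot]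
    simpa using h

theorem exists_traceSum_eq_natCast {p : MultiMatrix n} (hp : IsIdempotentElem p) :
    ∃ r : ℕ, traceSum n p = r ∧ (p ≠ 0 → 1 ≤ r) := by
  have h : ∀ i, IsIdempotentElem (p i) := fun i => congrFun hp i
  choose r hr hr' using fun i => Matrix.exists_trace_eq_natCast_of_isIdempotentElem (h i)
  refine ⟨∑ i, r i, by simp [traceSum_apply, hr], fun hp0 => ?_⟩
  obtain ⟨i, hi⟩ := Function.ne_iff.1 hp0
  exact (hr' i hi).trans (Finset.single_le_sum (f := r) (fun _ _ => Nat.zero_le _) (Finset.mem_univ i))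

theorem one_le_traceSum {p : MultiMatrix n} (hp : IsIdempotentElem p) (h : p ≠ 0) :
    1 ≤ traceSum n p := by
  obtain ⟨r, hr, hr'⟩ := exists_traceSum_eq_natCast hp
  rw [hr]
  exact_mod_cast hr' h

/-- A functional that is at least one on the nonzero projections, and whose value at the unit is
the rank, is the sum of the traces. -/
theorem eq_traceSum {f : MultiMatrix n →ₗ[ℂ] ℂ} (h1 : f 1 = ((∑ i, (n i : ℕ) : ℕ) : ℂ))
    (hf : ∀ p, IsStarProjection p → p ≠ 0 → 1 ≤ f p) : f = traceSum n := by
  have hdiag : ∀ i a, f (matrixUnit n i a a) = 1 := by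
    have hge : ∀ i a, 0 ≤ f (matrixUnit n i a a) - 1 := fun i a => sub_nonneg.2 <|
      hf _ (isStarProjection_matrixUnit i a) (matrixUnit_ne_zero i a a)
    -- The diagonal matrix units add up to 1 and their number is the rank, so the nonnegative
    -- excesses over 1 have sum zero.
    have hsum : ∑ i, ∑ a, (f (matrixUnit n i a a) - 1) = 0 := by
      simp only [Finset.sum_sub_distrib, ← map_sum, sum_matrixUnit_self, h1]
      simp
    intro i a
    have := (Finset.sum_eq_zero_iff_of_nonneg
      fun i _ => Finset.sum_nonneg fun a _ => hge i a).1 hsum i (Finset.mem_univ i)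
    exact sub_eq_zero.1 <|
      (Finset.sum_eq_zero_iff_of_nonneg fun a _ => hge i a).1 this a (Finset.mem_univ a)
  refine MultiMatrix.linearMap_ext fun i a b => ?_
  rw [traceSum_matrixUnit]
  split_ifs with hab
  · subst hab; exact hdiag i a
  -- For unimodular `z` the projection `p` below has both diagonal entries 1/2, which already
  -- contribute 1 to `f p`; hence the off-diagonal part contributes a nonnegative amount. The
  -- choices `z = ±1, ±I` then make both off-diagonal values vanish.
  have key : ∀ z : ℂ, z * star z = 1 →
      0 ≤ z * f (matrixUnit n i a b) + star z * f (matrixUnit n i b a) := by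
    intro z hz
    set p : MultiMatrix n := (2⁻¹ : ℂ) • (matrixUnit n i a a + z • matrixUnit n i a b +
      star z • matrixUnit n i b a + matrixUnit n i b b) with hp
    have hps : IsStarProjection p := by
      constructor
      · rw [IsIdempotentElem, hp, smul_mul_smul_comm]
        simp only [add_mul, mul_add, mul_smul_comm, smul_mul_assoc,
          matrixUnit_mul_matrixUnit, matrixUnit_mul_matrixUnit_of_ne _ _ _ hab,
          matrixUnit_mul_matrixUnit_of_ne _ _ _ (Ne.symm hab), smul_zero, add_zero, zero_add]
        match_scalars <;> first | ring1 | linear_combination (1 / 4 : ℂ) * hz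
      · rw [IsSelfAdjoint, hp]
        simp only [star_smul, star_add, star_matrixUnit, star_star]
        simp only [star_inv₀, star_ofNat]
        abel_nf
    have hp0 : p ≠ 0 := by
      intro h0
      have := congrFun (congrFun (congrFun h0 i) a) a
      simp [hp, matrixUnit, Ne.symm hab] at this
    have := hf p hps hp0
    rw [hp] at this
    simp only [map_smul, map_add, hdiag, smul_eq_mul] at this
    have h2 := mul_le_mul_of_nonneg_left this (show (0 : ℂ) ≤ 2 by norm_num)
    rw [← mul_assoc, mul_inv_cancel₀ (by norm_num), one_mul] at h2
    have h3 := sub_nonneg.2 h2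
    convert h3 using 1
    ring
  set u := f (matrixUnit n i a b)
  set v := f (matrixUnit n i b a)
  have k1 := key 1 (by simp)
  have k2 := key (-1) (by simp)
  have k3 := key Complex.I (by simp)
  have k4 := key (-Complex.I) (by simp)
  simp only [star_one, star_neg, Complex.star_def, Complex.conj_I, neg_mul, one_mul, neg_neg] at *
  have e1 : u + v = 0 := le_antisymm (by have := neg_nonneg.1 (by convert k2 using 1; ring : 0 ≤ -(u + v)); exact this) k1
  have e2 : Complex.I * u + -(Complex.I * v) = 0 :=
    le_antisymm (neg_nonneg.1 (by convert k4 using 1; ring : 0 ≤ -(Complex.I * u + -(Complex.I * v)))) k3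
  have e3 : u - v = 0 := by
    have : Complex.I * (u - v) = 0 := by rw [← e2]; ring
    simpa using this
  linear_combination (e1 + e3) / 2

/-- A tracial functional is determined by its values at the minimal projections. -/
theorem tracial_apply {f : MultiMatrix n →ₗ[ℂ] ℂ} (hf : ∀ x y, f (x * y) = f (y * x))
    (x : MultiMatrix n) : f x = ∑ j, f (minimalProjection n j) * (x j).trace := by
  have hu : ∀ i a b, f (matrixUnit n i a b) = if a = b then f (minimalProjection n i) else 0 := by
    intro i a b
    split_ifs with hab
    · subst hab
      rw [minimalProjection_eq, ← matrixUnit_mul_matrixUnit i a ⟨0, (n i).pos⟩ a, hf,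
        matrixUnit_mul_matrixUnit]
    · rw [← matrixUnit_mul_matrixUnit i a b b, hf, matrixUnit_mul_matrixUnit_of_ne _ _ _ (Ne.symm hab),
        map_zero]
  conv_lhs => rw [MultiMatrix.eq_sum_matrixUnit x]
  simp only [map_sum, map_smul, hu, smul_eq_mul, mul_ite, mul_zero, Finset.sum_ite_eq,
    Finset.mem_univ, if_true, Matrix.trace, Matrix.diag, Finset.mul_sum]
  exact Finset.sum_congr rfl fun i _ => Finset.sum_congr rfl fun a _ => mul_comm _ _

end MultiMatrix
end

noncomputable section

/-! ### Comparison of the norm with the sum of the traces -/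

section TraceSumNorm

open scoped ComplexOrder

variable {B : Type*} [CStarAlgebra B] {k : ℕ} {n : Fin k → ℕ+}

theorem IsStarProjection.norm_eq_one {p : B} (hp : IsStarProjection p) (h : p ≠ 0) : ‖p‖ = 1 := by
  have h1 := CStarRing.norm_star_mul_self (x := p)
  rw [hp.isSelfAdjoint.star_eq, hp.isIdempotentElem.eq] at h1
  have h2 : ‖p‖ ≠ 0 := norm_ne_zero_iff.2 h
  exact (mul_right_cancel₀ h2 (by rw [one_mul]; exact h1)).symm

/-- A diagonal entry of `χ b` is the scalar in a compression `p * b * p` with `‖p‖ = 1`, so the norm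
of `B` bounds it and no norm on the matrices is needed. -/
theorem norm_traceSum_le (χ : B ≃⋆ₐ[ℂ] MultiMatrix n) (b : B) :
    ‖traceSum n (χ b)‖ ≤ ((∑ i, (n i : ℕ) : ℕ) : ℝ) * ‖b‖ := by
  have h : ∀ i a, ‖χ b i a a‖ ≤ ‖b‖ := by
    intro i a
    set p : B := χ.symm (matrixUnit n i a a) with hp
    have hps : IsStarProjection p := (isStarProjection_matrixUnit i a).map χ.symm
    have hp0 : p ≠ 0 := by
      intro h0
      apply matrixUnit_ne_zero i a a
      rw [← χ.apply_symm_apply (matrixUnit n i a a), ← hp, h0, map_zero]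
    have hpb : p * b * p = χ b i a a • p := by
      apply EquivLike.injective χ
      rw [map_mul, map_mul, map_smul, hp, χ.apply_symm_apply, matrixUnit_conj i a a]
    have h1 : ‖p * b * p‖ ≤ 1 * ‖b‖ * 1 := by
      refine (norm_mul_le _ _).trans ?_
      rw [hps.norm_eq_one hp0]
      refine mul_le_mul_of_nonneg_right ((norm_mul_le _ _).trans ?_) zero_le_one
      rw [hps.norm_eq_one hp0]
    rwa [hpb, norm_smul, hps.norm_eq_one hp0, mul_one, mul_one, one_mul] at h1
  rw [traceSum_apply]
  calc ‖∑ i, (χ b i).trace‖ ≤ ∑ i, ∑ _a : Fin (n i), ‖b‖ :=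
        (norm_sum_le _ _).trans <| Finset.sum_le_sum fun i _ =>
          (norm_sum_le _ _).trans <| Finset.sum_le_sum fun a _ => h i a
    _ = _ := by simp [Finset.sum_mul]

/-- The norm of a positive element lies in its spectrum, so it is an eigenvalue in one of the
factors; all eigenvalues are nonnegative, so the trace dominates it. -/
theorem norm_le_traceSum (χ : B ≃⋆ₐ[ℂ] MultiMatrix n) (b : B) :
    (‖star b * b‖ : ℂ) ≤ traceSum n (χ (star b * b)) := by
  have hpsd : ∀ i, (χ (star b * b) i).PosSemidef := fun i => by
    rw [map_mul, map_star]
    exact Matrix.posSemidef_conjTranspose_mul_self (χ b i)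
  have htr : ∀ i, 0 ≤ (χ (star b * b) i).trace := fun i => (hpsd i).trace_nonneg
  rcases subsingleton_or_nontrivial B with hB | hB
  · rw [Subsingleton.elim (star b * b) 0]; simp
  let := CStarAlgebra.spectralOrder B
  have := CStarAlgebra.spectralOrderedRing B
  have h1 : ‖star b * b‖ ∈ spectrum ℝ (star b * b) :=
    CStarAlgebra.norm_mem_spectrum_of_nonneg (star_mul_self_nonneg b)
  have h2 : ‖star b * b‖ ∈ spectrum ℝ (χ (star b * b)) := by
    refine AlgHom.spectrum_apply_subset
      ((χ.symm : MultiMatrix n →⋆ₐ[ℂ] B).toAlgHom.restrictScalars ℝ) (χ (star b * b)) ?_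
    change _ ∈ spectrum ℝ (χ.symm (χ (star b * b)))
    rwa [χ.symm_apply_apply]
  rw [Pi.spectrum_eq, Set.mem_iUnion] at h2
  obtain ⟨i, hi⟩ := h2
  rw [(hpsd i).isHermitian.spectrum_real_eq_range_eigenvalues] at hi
  obtain ⟨a, ha⟩ := hi
  rw [traceSum_apply]
  refine le_trans ?_ (Finset.single_le_sum (f := fun i => (χ (star b * b) i).trace)
    (fun i _ => htr i) (Finset.mem_univ i))
  rw [(hpsd i).isHermitian.trace_eq_sum_eigenvalues, ← ha]
  exact Finset.single_le_sum (f := fun a => (((hpsd i).isHermitian.eigenvalues a : ℝ) : ℂ))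
    (fun a _ => by exact_mod_cast (hpsd i).eigenvalues_nonneg a) (Finset.mem_univ a)

end TraceSumNorm

/-! ### The rank of a multi-matrix algebra -/

section Rank

open scoped ComplexOrder

variable {B : Type*} [CStarAlgebra B] {k : ℕ} {n : Fin k → ℕ+}

/-- The irreducible representation on the `i`-th factor. -/
def factorRep (χ : B ≃⋆ₐ[ℂ] MultiMatrix n) (i : Fin k) : IrrepFD B where
  dim := n i
  dim_pos := (n i).pos
  rep := (Pi.evalStarAlgHom ℂ (fun i => Matrix (Fin (n i)) (Fin (n i)) ℂ) i).comp
    (χ : B →⋆ₐ[ℂ] MultiMatrix n)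
  irreducible W hW := by
    by_cases h : W = ⊥
    · exact Or.inl h
    right
    obtain ⟨w, hw, hw0⟩ := W.ne_bot_iff.1 h
    obtain ⟨a, ha⟩ := Function.ne_iff.1 hw0
    have hs : ∀ b, Pi.single b 1 ∈ W := by
      intro b
      have h1 := hW (χ.symm (matrixUnit n i b a)) w hw
      have h2 : ((Pi.evalStarAlgHom ℂ (fun i => Matrix (Fin (n i)) (Fin (n i)) ℂ) i).comp
          (χ : B →⋆ₐ[ℂ] MultiMatrix n)) (χ.symm (matrixUnit n i b a)) =
          Matrix.single b a 1 := by
        change χ (χ.symm (matrixUnit n i b a)) i = _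
        rw [χ.apply_symm_apply]
        simp [matrixUnit]
      rw [h2, Matrix.single_mulVec] at h1
      have h3 := W.smul_mem (w a)⁻¹ h1
      convert h3 using 1
      ext c
      by_cases hc : c = b
      · subst hc; simpa using (inv_mul_cancel₀ ha).symm
      · simp [hc]
    rw [eq_top_iff]
    intro v _
    rw [← Finset.univ_sum_single v]
    refine W.sum_mem fun b _ => ?_
    have := W.smul_mem (v b) (hs b)
    rwa [← Pi.single_smul, smul_eq_mul, mul_one] at this

theorem IrrepFD.Equivalent.symm {σ τ : IrrepFD B} (h : σ.Equivalent τ) : τ.Equivalent σ := by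
  obtain ⟨u, h1, h2, h3⟩ := h
  refine ⟨u.conjTranspose, by simpa using h2, by simpa using h1, fun b => ?_⟩
  calc u.conjTranspose * σ.rep b = u.conjTranspose * (σ.rep b * u) * u.conjTranspose := by
        rw [Matrix.mul_assoc, Matrix.mul_assoc, h1, Matrix.mul_one]
    _ = τ.rep b * u.conjTranspose := by
        rw [← h3, ← Matrix.mul_assoc, h2, Matrix.one_mul]

theorem IrrepFD.Equivalent.trans {σ τ ρ : IrrepFD B} (h : σ.Equivalent τ) (h' : τ.Equivalent ρ) :
    σ.Equivalent ρ := by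
  obtain ⟨u, h1, h2, h3⟩ := h
  obtain ⟨v, h1', h2', h3'⟩ := h'
  refine ⟨u * v, ?_, ?_, fun b => ?_⟩
  · rw [Matrix.conjTranspose_mul, Matrix.mul_assoc, ← Matrix.mul_assoc v, h1', Matrix.one_mul, h1]
  · rw [Matrix.conjTranspose_mul, Matrix.mul_assoc, ← Matrix.mul_assoc _ u, h2, Matrix.one_mul, h2']
  · rw [Matrix.mul_assoc, h3', ← Matrix.mul_assoc, h3, Matrix.mul_assoc]

theorem IrrepFD.Equivalent.dim_eq {σ τ : IrrepFD B} (h : σ.Equivalent τ) : σ.dim = τ.dim := by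
  obtain ⟨u, h1, h2, -⟩ := h
  have e1 : ((σ.dim : ℕ) : ℂ) = τ.dim := by
    calc ((σ.dim : ℕ) : ℂ) = (u * u.conjTranspose).trace := by simp [h1]
      _ = (u.conjTranspose * u).trace := Matrix.trace_mul_comm _ _
      _ = τ.dim := by simp [h2]
  exact_mod_cast e1

theorem factorRep_not_equivalent (χ : B ≃⋆ₐ[ℂ] MultiMatrix n) {i j : Fin k} (hij : i ≠ j) :
    ¬ (factorRep χ i).Equivalent (factorRep χ j) := by
  rintro ⟨u, h1, -, h3⟩
  have h := h3 (χ.symm (Pi.single i 1))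
  have e1 : (factorRep χ j).rep (χ.symm (Pi.single i 1)) = 0 := by
    change χ (χ.symm (Pi.single i 1)) j = 0
    rw [χ.apply_symm_apply, Pi.single_eq_of_ne hij.symm]
  have e2 : (factorRep χ i).rep (χ.symm (Pi.single i 1)) = 1 := by
    change χ (χ.symm (Pi.single i 1)) i = 1
    rw [χ.apply_symm_apply, Pi.single_eq_same]
  rw [e1, e2, Matrix.mul_zero, Matrix.one_mul] at h
  rw [← h, Matrix.zero_mul] at h1
  have := congrFun (congrFun h1 ⟨0, (factorRep χ i).dim_pos⟩) ⟨0, (factorRep χ i).dim_pos⟩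
  simp at this

theorem mul_matrixUnit (x : MultiMatrix n) (i : Fin k) (a b : Fin (n i)) :
    x * matrixUnit n i a b = ∑ c, x i c a • matrixUnit n i c b := by
  funext j
  by_cases hj : j = i
  · subst hj
    rw [Finset.sum_apply]
    ext c d
    rw [Matrix.sum_apply]
    simp [matrixUnit, Matrix.mul_apply, Matrix.single_apply, ite_and]
  · simp [matrixUnit, Pi.single_eq_of_ne hj, Finset.sum_apply]

/-- Every irreducible representation is equivalent to the one on some factor. -/
theorem exists_equivalent_factorRep (χ : B ≃⋆ₐ[ℂ] MultiMatrix n) (σ : IrrepFD B) :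
    ∃ i, σ.Equivalent (factorRep χ i) := by
  set ρ : MultiMatrix n →⋆ₐ[ℂ] Matrix (Fin σ.dim) (Fin σ.dim) ℂ :=
    σ.rep.comp (χ.symm : MultiMatrix n →⋆ₐ[ℂ] B) with hρ
  have hρb : ∀ b, ρ (χ b) = σ.rep b := fun b => congrArg σ.rep (χ.symm_apply_apply b)
  have : NeZero σ.dim := ⟨σ.dim_pos.ne'⟩
  obtain ⟨i, a₀, h0⟩ : ∃ i a, ρ (matrixUnit n i a a) ≠ 0 := by
    by_contra! hcon
    have h1 : ρ 1 = 0 := by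
      rw [← sum_matrixUnit_self]
      simp only [map_sum, hcon, Finset.sum_const_zero]
    rw [map_one] at h1
    exact one_ne_zero h1
  refine ⟨i, ?_⟩
  obtain ⟨v, hv⟩ : ∃ v, (ρ (matrixUnit n i a₀ a₀)).mulVec v ≠ 0 := by
    by_contra! hcon
    exact h0 (Matrix.mulVec_injective (funext fun v => by rw [hcon, Matrix.zero_mulVec]))
  -- The vectors `w b` are orthogonal with common squared length `N`, and `ρ` acts on them as the
  -- `i`-th factor acts on the standard basis. So the matrix `U` with these columns intertwines, `t
  -- • U` is an isometry for a normalizing `t`, and irreducibility makes it onto.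
  set w : Fin (n i) → Fin σ.dim → ℂ := fun b => (ρ (matrixUnit n i b a₀)).mulVec v with hw
  set U : Matrix (Fin σ.dim) (Fin (n i)) ℂ := Matrix.of fun c b => w b c with hU
  have hUsingle : ∀ b, U.mulVec (Pi.single b 1) = w b := fun b => by
    rw [Matrix.mulVec_single_one]; rfl
  have hρw : ∀ x b, (ρ x).mulVec (w b) = ∑ c, x i c b • w c := fun x b => by
    rw [hw, Matrix.mulVec_mulVec, ← map_mul, mul_matrixUnit, map_sum, Matrix.sum_mulVec]
    exact Finset.sum_congr rfl fun c _ => by rw [map_smul, Matrix.smul_mulVec]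
  have hinter : ∀ x, U * x i = ρ x * U := fun x => by
    ext c b
    have := congrFun (hρw x b) c
    rw [Finset.sum_apply] at this
    simp only [Matrix.mul_apply, hU, Matrix.of_apply]
    simp only [Matrix.mulVec, dotProduct, Pi.smul_apply, smul_eq_mul] at this
    rw [this]
    exact Finset.sum_congr rfl fun d _ => mul_comm _ _
  set N : ℂ := star v ⬝ᵥ w a₀ with hN
  have hinner : ∀ b c, star (w b) ⬝ᵥ w c = if b = c then N else 0 := fun b c => by
    have h1 : star (w b) ⬝ᵥ w c =
        star v ⬝ᵥ (ρ (matrixUnit n i a₀ b * matrixUnit n i c a₀)).mulVec v := by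
      rw [hw, Matrix.star_mulVec, ← Matrix.dotProduct_mulVec, Matrix.mulVec_mulVec,
        ← Matrix.star_eq_conjTranspose, ← map_star, star_matrixUnit, ← map_mul]
    rw [h1]
    split_ifs with h
    · subst h; rw [matrixUnit_mul_matrixUnit]
    · rw [matrixUnit_mul_matrixUnit_of_ne _ _ _ h, map_zero, Matrix.zero_mulVec,
        dotProduct_zero]
  have hNpos : 0 < N := by
    have := Matrix.dotProduct_star_self_pos_iff.2 hv
    exact this.trans_eq ((hinner a₀ a₀).trans (if_pos rfl))
  have hUU : U.conjTranspose * U = N • 1 := by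
    ext b c
    have := hinner b c
    simp only [dotProduct, Pi.star_apply, Complex.star_def] at this
    simp [Matrix.mul_apply, hU, this, Matrix.one_apply]
  obtain ⟨t, ht⟩ : ∃ t : ℂ, star t * t * N = 1 := by
    obtain ⟨r, hr⟩ : ∃ r : ℝ, N = r := ⟨N.re, (Complex.eq_re_of_ofReal_le hNpos.le)⟩
    have hr0 : 0 < r := by rw [hr] at hNpos; exact_mod_cast hNpos
    refine ⟨((Real.sqrt r)⁻¹ : ℝ), ?_⟩
    rw [hr, Complex.star_def, Complex.conj_ofReal]
    norm_cast
    rw [← mul_inv, Real.mul_self_sqrt hr0.le, inv_mul_cancel₀ hr0.ne']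
  have huu : (t • U).conjTranspose * (t • U) = 1 := by
    rw [Matrix.conjTranspose_smul, Matrix.smul_mul, Matrix.mul_smul, hUU, smul_smul, smul_smul,
      ht, one_smul]
  have hspan : Submodule.span ℂ (Set.range w) = ⊤ := by
    refine (σ.irreducible _ fun b x hx => ?_).resolve_left ?_
    · rw [← hρb]
      induction hx using Submodule.span_induction with
      | mem x hx =>
        obtain ⟨c, rfl⟩ := hx
        rw [hρw]
        exact Submodule.sum_mem _ fun d _ => Submodule.smul_mem _ _ (Submodule.subset_span ⟨d, rfl⟩)
      | zero => rw [Matrix.mulVec_zero]; exact Submodule.zero_mem _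
      | add x y _ _ hx hy => rw [Matrix.mulVec_add]; exact Submodule.add_mem _ hx hy
      | smul c x _ hx => rw [Matrix.mulVec_smul]; exact Submodule.smul_mem _ _ hx
    · exact (Submodule.ne_bot_iff _).2 ⟨w a₀, Submodule.subset_span ⟨a₀, rfl⟩, hv⟩
  have hco : (t • U) * (t • U).conjTranspose = 1 := by
    refine Matrix.mulVec_injective (funext fun x => ?_)
    have hx : x ∈ Submodule.span ℂ (Set.range w) := hspan ▸ Submodule.mem_top
    rw [Matrix.one_mulVec]
    induction hx using Submodule.span_induction with
    | mem x hx =>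
      obtain ⟨c, rfl⟩ := hx
      have ht0 : t ≠ 0 := by rintro rfl; simp at ht
      have h1 : w c = (t • U).mulVec (t⁻¹ • Pi.single c 1) := by
        rw [Matrix.smul_mulVec, Matrix.mulVec_smul, smul_smul, mul_inv_cancel₀ ht0, one_smul,
          hUsingle]
      rw [h1, Matrix.mulVec_mulVec, Matrix.mul_assoc, huu, Matrix.mul_one]
    | zero => rw [Matrix.mulVec_zero]
    | add x y _ _ hx hy => rw [Matrix.mulVec_add, hx, hy]
    | smul c x _ hx => rw [Matrix.mulVec_smul, hx]
  have hint : ∀ b, (t • U) * χ b i = σ.rep b * (t • U) := fun b => by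
    rw [← hρb, Matrix.mul_smul, ← hinter, Matrix.smul_mul]
  exact ⟨t • U, hco, huu, hint⟩

/-- Inequivalent irreducible representations are carried by different factors, which bounds every
admissible sum; the set of all `factorRep χ i` attains the bound. -/
theorem cstarRank_eq (χ : B ≃⋆ₐ[ℂ] MultiMatrix n) :
    cstarRank B = ((∑ i, (n i : ℕ) : ℕ) : ℕ∞) := by
  apply le_antisymm
  · refine iSup₂_le fun s hs => ?_
    choose g hg using exists_equivalent_factorRep χ
    have hinj : Set.InjOn g s := by
      intro σ hσ τ hτ hστ
      by_contra hne
      exact hs hσ hτ hne ((hg σ).trans (hστ ▸ (hg τ).symm))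
    have hdim : ∀ σ, σ.dim = n (g σ) := fun σ => (hg σ).dim_eq
    calc ∑ σ ∈ s, (σ.dim : ℕ∞) = ((∑ σ ∈ s, (n (g σ) : ℕ) : ℕ) : ℕ∞) := by
          rw [Nat.cast_sum]; exact Finset.sum_congr rfl fun σ _ => by rw [hdim]
      _ = ((∑ i ∈ s.image g, (n i : ℕ) : ℕ) : ℕ∞) := by rw [Finset.sum_image hinj]
      _ ≤ _ := by
          exact_mod_cast Finset.sum_le_sum_of_subset (Finset.subset_univ _)
  · have hinj : Function.Injective (factorRep χ) := by
      intro i j hij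
      by_contra hne
      refine factorRep_not_equivalent χ hne ?_
      rw [hij]
      exact ⟨1, by simp, by simp, by simp⟩
    refine le_trans (le_of_eq ?_) (le_iSup₂ (Finset.univ.map ⟨factorRep χ, hinj⟩) ?_)
    · rw [Finset.sum_map, Nat.cast_sum]
      rfl
    · intro σ hσ τ hτ hne
      simp only [Finset.coe_map, Function.Embedding.coeFn_mk, Finset.coe_univ, Set.image_univ,
        Set.mem_range] at hσ hτ
      obtain ⟨i, rfl⟩ := hσ
      obtain ⟨j, rfl⟩ := hτ
      exact factorRep_not_equivalent χ fun h => hne (congrArg _ h)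

end Rank
end

noncomputable section

/-! ### Systems of matrix units -/

section MatrixUnits

variable {B : Type*} [CStarAlgebra B] {k : ℕ} {n : Fin k → ℕ+}

/-- A system of matrix units of type `n` in a unital C*-algebra. -/
structure IsMatrixUnitSystem (e : ∀ i, Fin (n i) → Fin (n i) → B) : Prop where
  mul_same : ∀ i a b c, e i a b * e i b c = e i a c
  mul_of_ne : ∀ i a b b' c, b ≠ b' → e i a b * e i b' c = 0
  mul_of_ne_factor : ∀ i j a b c d, i ≠ j → e i a b * e j c d = 0
  star_eq : ∀ i a b, star (e i a b) = e i b a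
  sum_eq_one : ∑ i, ∑ a, e i a a = 1

variable {e : ∀ i, Fin (n i) → Fin (n i) → B}

/-- The linear map sending the standard matrix units to the elements `e`. -/
def matrixUnitLinearMap (e : ∀ i, Fin (n i) → Fin (n i) → B) : MultiMatrix n →ₗ[ℂ] B where
  toFun x := ∑ i, ∑ a, ∑ b, x i a b • e i a b
  map_add' x y := by simp [add_smul, Finset.sum_add_distrib]
  map_smul' c x := by simp [Finset.smul_sum, smul_smul]

theorem matrixUnitLinearMap_apply (x : MultiMatrix n) :
    matrixUnitLinearMap e x = ∑ i, ∑ a, ∑ b, x i a b • e i a b := rfl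

theorem matrixUnitLinearMap_matrixUnit (i : Fin k) (a b : Fin (n i)) :
    matrixUnitLinearMap e (matrixUnit n i a b) = e i a b := by
  rw [matrixUnitLinearMap_apply, Finset.sum_eq_single i, Finset.sum_eq_single a,
    Finset.sum_eq_single b]
  · simp [matrixUnit]
  · intro b' _ hb; simp [matrixUnit, hb.symm]
  · simp
  · intro a' _ ha; simp [matrixUnit, ha.symm]
  · simp
  · intro j _ hj; simp [matrixUnit, Pi.single_eq_of_ne hj]
  · simp

namespace IsMatrixUnitSystem

variable (he : IsMatrixUnitSystem e)

/-- The unital *-homomorphism defined by a system of matrix units. -/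
def hom : MultiMatrix n →⋆ₐ[ℂ] B where
  toFun := matrixUnitLinearMap e
  map_one' := by
    rw [← sum_matrixUnit_self]
    simp only [map_sum, matrixUnitLinearMap_matrixUnit, he.sum_eq_one]
  map_zero' := map_zero _
  map_add' := map_add _
  map_mul' := by
    have h : (LinearMap.mul ℂ (MultiMatrix n)).compr₂ (matrixUnitLinearMap e) =
        (LinearMap.mul ℂ B).compl₁₂ (matrixUnitLinearMap e) (matrixUnitLinearMap e) := by
      refine MultiMatrix.linearMap_ext fun i a b => MultiMatrix.linearMap_ext fun j c d => ?_
      simp only [LinearMap.compr₂_apply, LinearMap.mul_apply', LinearMap.compl₁₂_apply,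
        matrixUnitLinearMap_matrixUnit]
      by_cases hij : i = j
      · subst hij
        by_cases hbc : b = c
        · subst hbc
          rw [matrixUnit_mul_matrixUnit, matrixUnitLinearMap_matrixUnit, he.mul_same]
        · rw [matrixUnit_mul_matrixUnit_of_ne _ _ _ hbc, map_zero, he.mul_of_ne _ _ _ _ _ hbc]
      · rw [matrixUnit_mul_matrixUnit_of_ne_factor hij, map_zero, he.mul_of_ne_factor _ _ _ _ _ _ hij]
    exact fun x y => LinearMap.congr_fun (LinearMap.congr_fun h x) y
  commutes' c := by
    rw [Algebra.algebraMap_eq_smul_one, Algebra.algebraMap_eq_smul_one, map_smul,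
      ← sum_matrixUnit_self]
    simp only [map_sum, matrixUnitLinearMap_matrixUnit, he.sum_eq_one]
  map_star' x := by
    simp only [matrixUnitLinearMap_apply, star_sum, star_smul, he.star_eq]
    exact Finset.sum_congr rfl fun i _ => Finset.sum_comm

theorem hom_apply (x : MultiMatrix n) : he.hom x = ∑ i, ∑ a, ∑ b, x i a b • e i a b := rfl

theorem hom_matrixUnit (i : Fin k) (a b : Fin (n i)) : he.hom (matrixUnit n i a b) = e i a b :=
  matrixUnitLinearMap_matrixUnit i a b

theorem hom_injective (h0 : ∀ i a, e i a a ≠ 0) : Function.Injective he.hom := by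
  rw [injective_iff_map_eq_zero]
  intro x hx
  rw [MultiMatrix.eq_sum_matrixUnit x]
  refine Finset.sum_eq_zero fun i _ => Finset.sum_eq_zero fun a _ => Finset.sum_eq_zero fun b _ => ?_
  have h1 := congrArg he.hom (matrixUnit_conj i a b x)
  rw [map_mul, map_mul, hx, mul_zero, zero_mul, map_smul, he.hom_matrixUnit] at h1
  have h2 : e i a b ≠ 0 := fun h => h0 i a (by rw [← he.mul_same i a b a, h, zero_mul])
  rw [(smul_eq_zero.1 h1.symm).resolve_right h2, zero_smul]

end IsMatrixUnitSystem

/-- Partial isometries with a common initial projection in each factor, and with final projections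
that add up to one, define a system of matrix units. -/
theorem isMatrixUnitSystem_of_partialIsometries {p : Fin k → B} {u : ∀ i, Fin (n i) → B}
    (h_same : ∀ i a, star (u i a) * u i a = p i) (hup : ∀ i a, u i a * p i = u i a)
    (h_ne : ∀ i a b, a ≠ b → star (u i a) * u i b = 0)
    (h_ne_factor : ∀ i j a b, i ≠ j → star (u i a) * u j b = 0)
    (h_sum : ∑ i, ∑ a, u i a * star (u i a) = 1) :
    IsMatrixUnitSystem fun i a b => u i a * star (u i b) where
  mul_same i a b c := by
    rw [mul_assoc, ← mul_assoc (star (u i b)), h_same, ← mul_assoc, hup]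
  mul_of_ne i a b b' c h := by
    rw [mul_assoc, ← mul_assoc (star (u i b)), h_ne i b b' h, zero_mul, mul_zero]
  mul_of_ne_factor i j a b c d h := by
    rw [mul_assoc, ← mul_assoc (star (u i b)), h_ne_factor i j b c h, zero_mul, mul_zero]
  star_eq i a b := by rw [star_mul, star_star]
  sum_eq_one := h_sum

end MatrixUnits

/-! ### Finite-dimensional C*-algebras are multi-matrix algebras -/

section Structure

variable {B : Type*} [CStarAlgebra B]

/-- The spectrum consists of roots of the minimal polynomial. Consequently every function is
continuous on it, and the functional calculus accepts indicator functions. -/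
theorem finite_spectrum_real [FiniteDimensional ℂ B] (a : B) : (spectrum ℝ a).Finite := by
  rcases subsingleton_or_nontrivial B with hB | hB
  · simp [spectrum.of_subsingleton]
  have : FiniteDimensional ℝ B := FiniteDimensional.complexToReal B
  have hint : IsIntegral ℝ a := Algebra.IsIntegral.isIntegral a
  refine ((minpoly ℝ a).roots.toFinset.finite_toSet).subset fun t ht => ?_
  have h := spectrum.subset_polynomial_aeval a (minpoly ℝ a) ⟨t, ht, rfl⟩
  rw [minpoly.aeval, spectrum.zero_eq] at h
  simpa [minpoly.ne_zero hint] using h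

theorem IsStarProjection.mul_eq_of_mul_eq {p q : B} (hp : IsStarProjection p)
    (hq : IsStarProjection q) (h : q * p = q) : p * q = q := by
  have := congrArg star h
  rwa [star_mul, hp.isSelfAdjoint.star_eq, hq.isSelfAdjoint.star_eq] at this

/-- A finite-dimensional C*-algebra has a partition of unity into minimal projections. -/
theorem exists_minimal_projections (B : Type*) [CStarAlgebra B] [FiniteDimensional ℂ B] :
    ∃ (r : ℕ) (p : Fin r → B), (∀ i, IsStarProjection (p i)) ∧ (∀ i, p i ≠ 0) ∧
      (∀ i j, i ≠ j → p i * p j = 0) ∧ ∑ i, p i = 1 ∧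
      ∀ i q, IsStarProjection q → q * p i = q → q = 0 ∨ q = p i := by
  classical
  -- A partition of unity with the largest number of members has minimal members: a proper nonzero
  -- subprojection `q` of `p i` would split `p i` into `q` and `p i - q`.
  set S : Set ℕ := {r | ∃ p : Fin r → B, (∀ i, IsStarProjection (p i)) ∧ (∀ i, p i ≠ 0) ∧
      (∀ i j, i ≠ j → p i * p j = 0) ∧ ∑ i, p i = 1} with hS
  have hne : S.Nonempty := by
    rcases subsingleton_or_nontrivial B with hB | hB
    · exact ⟨0, Fin.elim0, fun i => i.elim0, fun i => i.elim0, fun i => i.elim0,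
        Subsingleton.elim _ _⟩
    · exact ⟨1, fun _ => 1, fun _ => .one B, fun _ => one_ne_zero,
        fun i j h => (h (Subsingleton.elim i j)).elim, by simp⟩
  have hbdd : BddAbove S := by
    refine ⟨Module.finrank ℂ B, ?_⟩
    rintro r ⟨p, hp, hp0, hpp, -⟩
    have hli : LinearIndependent ℂ p := by
      rw [Fintype.linearIndependent_iff]
      intro g hg j
      have h := congrArg (p j * ·) hg
      simp only [Finset.mul_sum, mul_zero, mul_smul_comm] at h
      rw [Finset.sum_eq_single j (fun i _ hi => by rw [hpp j i hi.symm, smul_zero]) (by simp),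
        (hp j).isIdempotentElem.eq] at h
      exact (smul_eq_zero.1 h).resolve_right (hp0 j)
    simpa using hli.fintype_card_le_finrank
  obtain ⟨p, hp, hp0, hpp, hsum⟩ := Nat.sSup_mem hne hbdd
  refine ⟨_, p, hp, hp0, hpp, hsum, fun i q hq hqp => ?_⟩
  by_contra! hcon
  have hpq := (hp i).mul_eq_of_mul_eq hq hqp
  have hqq := hq.isIdempotentElem.eq
  have hii := (hp i).isIdempotentElem.eq
  have hd : IsStarProjection (p i - q) := hq.sub_of_mul_eq_left (hp i) hqp
  have hpk : ∀ k, k ≠ i → q * p k = 0 := fun k hk => by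
    rw [← hqp, mul_assoc, hpp i k hk.symm, mul_zero]
  have hkp : ∀ k, k ≠ i → p k * q = 0 := fun k hk => by
    rw [← hpq, ← mul_assoc, hpp k i hk, zero_mul]
  set p' := Function.update p i (p i - q) with hp'
  have hp'i : p' i = p i - q := Function.update_self ..
  have hp'k : ∀ k, k ≠ i → p' k = p k := fun k hk => Function.update_of_ne hk ..
  have hmem : sSup S + 1 ∈ S := by
    refine ⟨Fin.cons q p', ?_, ?_, ?_, ?_⟩
    · refine Fin.cases hq fun k => ?_
      rw [Fin.cons_succ]
      by_cases hk : k = i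
      · rw [hk, hp'i]; exact hd
      · rw [hp'k k hk]; exact hp k
    · refine Fin.cases hcon.1 fun k => ?_
      rw [Fin.cons_succ]
      by_cases hk : k = i
      · rw [hk, hp'i]; exact sub_ne_zero.2 (Ne.symm hcon.2)
      · rw [hp'k k hk]; exact hp0 k
    · refine Fin.cases (Fin.cases (fun h => (h rfl).elim) fun k _ => ?_)
        fun k => Fin.cases (fun _ => ?_) fun l hkl => ?_
      · rw [Fin.cons_succ, Fin.cons_zero]
        by_cases hk : k = i
        · rw [hk, hp'i, mul_sub, hqp, hqq, sub_self]
        · rw [hp'k k hk, hpk k hk]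
      · rw [Fin.cons_succ, Fin.cons_zero]
        by_cases hk : k = i
        · rw [hk, hp'i, sub_mul, hpq, hqq, sub_self]
        · rw [hp'k k hk, hkp k hk]
      · rw [Fin.cons_succ, Fin.cons_succ]
        have hkl' : k ≠ l := fun h => hkl (by rw [h])
        by_cases hk : k = i
        · subst hk
          rw [hp'i, hp'k l hkl'.symm, sub_mul, hpp k l hkl', hpk l hkl'.symm, sub_zero]
        · by_cases hl : l = i
          · subst hl
            rw [hp'i, hp'k k hk, mul_sub, hpp k l hk, hkp k hk, sub_zero]
          · rw [hp'k k hk, hp'k l hl, hpp k l hkl']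
    · rw [Fin.sum_univ_succ, Fin.cons_zero]
      simp only [Fin.cons_succ]
      rw [hp', Finset.sum_update_of_mem (Finset.mem_univ i), ← hsum,
        ← Finset.add_sum_erase _ p (Finset.mem_univ i), Finset.sdiff_singleton_eq_erase]
      abel
  have := le_csSup hbdd hmem
  omega

/-- For self-adjoint `a` in the corner of `p` and a nonzero spectral value `t`, the spectral
projection of `a` at `t` lies under `p`, hence equals `p`, and `a = t • p`. Real and imaginary parts
give the general case. -/
theorem exists_smul_of_minimal [FiniteDimensional ℂ B] {p : B} (hp : IsStarProjection p)
    (hmin : ∀ q, IsStarProjection q → q * p = q → q = 0 ∨ q = p) (b : B) :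
    ∃ c : ℂ, p * b * p = c • p := by
  classical
  have hpp := hp.isIdempotentElem.eq
  have hsa : ∀ a : B, IsSelfAdjoint a → a * p = a → ∃ c : ℝ, a = c • p := by
    intro a ha hap
    by_cases h0 : a = 0
    · exact ⟨0, by rw [h0, zero_smul]⟩
    have hfin := finite_spectrum_real a
    obtain ⟨t, ht, ht0⟩ : ∃ t ∈ spectrum ℝ a, t ≠ 0 := by
      by_contra! hcon
      apply h0
      rw [← cfc_id ℝ a, ← cfc_zero ℝ a]
      exact cfc_congr fun t ht => hcon t ht
    have hc : ∀ f : ℝ → ℝ, ContinuousOn f (spectrum ℝ a) := fun f => hfin.continuousOn f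
    set f : ℝ → ℝ := fun s => if s = t then 1 else 0 with hf
    set q := cfc f a with hq
    have hqproj : IsStarProjection q := by
      refine ⟨?_, cfc_predicate f a⟩
      rw [IsIdempotentElem, hq, ← cfc_mul f f a (hc _) (hc _)]
      exact cfc_congr fun s _ => by simp [hf]
    have haq : a * q = t • q := by
      rw [hq, ← cfc_smul t f a (hc _)]
      nth_rw 1 [← cfc_id' ℝ a]
      rw [← cfc_mul _ f a (hc _) (hc _)]
      exact cfc_congr fun s _ => by by_cases hs : s = t <;> simp [hf, hs]
    have hqa : q * a = t • q := by
      have := congrArg star haq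
      rwa [star_mul, star_smul, hqproj.isSelfAdjoint.star_eq, ha.star_eq, star_trivial] at this
    have hq0 : q ≠ 0 := by
      intro h
      rw [hq, ← cfc_zero ℝ a, cfc_eq_cfc_iff_eqOn (hf := hc _) (hg := hc _)] at h
      have := h ht
      simp [hf] at this
    have hqp : q * p = q := by
      have h1 : q = t⁻¹ • (q * a) := by rw [hqa, smul_smul, inv_mul_cancel₀ ht0, one_smul]
      rw [h1, smul_mul_assoc, mul_assoc, hap]
    rcases hmin q hqproj hqp with h | h
    · exact (hq0 h).elim
    · exact ⟨t, by rw [← h, ← haq, h, hap]⟩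
  have hre : ∀ a : B, IsSelfAdjoint a → ∃ c : ℝ, p * a * p = c • p := fun a ha => by
    refine hsa _ ?_ (by rw [mul_assoc, hpp])
    rw [IsSelfAdjoint, star_mul, star_mul, hp.isSelfAdjoint.star_eq, ha.star_eq, mul_assoc]
  obtain ⟨c, hc⟩ := hre _ (realPart b).2
  obtain ⟨d, hd⟩ := hre _ (imaginaryPart b).2
  refine ⟨c + Complex.I * d, ?_⟩
  nth_rw 1 [← realPart_add_I_smul_imaginaryPart b]
  rw [mul_add, add_mul, hc, mul_smul_comm, smul_mul_assoc, hd, add_smul, mul_smul,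
    Complex.coe_smul, Complex.coe_smul]

/-- Murray-von Neumann equivalence of projections, with a normalized partial isometry. -/
def MvNEquiv (p q : B) : Prop :=
  ∃ u : B, star u * u = q ∧ u * star u = p ∧ p * u = u ∧ u * q = u

/-- Self-adjointness makes `c` real; if `c` were negative, both `star a * a` and its negative would
be positive. This reads off scalar inequalities in fibres, which carry no fixed order. -/
theorem nonneg_of_star_mul_self_eq_smul {q a : B} (hq : IsStarProjection q) (hq0 : q ≠ 0) {c : ℂ}
    (h : star a * a = c • q) : ∃ r : ℝ, 0 ≤ r ∧ c = r := by
  let := CStarAlgebra.spectralOrder B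
  have := CStarAlgebra.spectralOrderedRing B
  have hqs := hq.isSelfAdjoint.star_eq
  have hcreal : star c = c := by
    have h1 := congrArg star h
    rw [star_mul, star_star, star_smul, hqs, h] at h1
    exact (smul_left_injective ℂ hq0 h1).symm
  refine ⟨c.re, ?_, (Complex.conj_eq_iff_re.1 hcreal).symm⟩
  rw [← Complex.conj_eq_iff_re.1 hcreal, Complex.coe_smul] at h
  by_contra! hr
  have h1 : 0 ≤ (-c.re) • q := by
    rw [← hq.isIdempotentElem.eq]
    nth_rw 1 [← hqs]
    exact smul_nonneg (by linarith) (star_mul_self_nonneg q)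
  rw [neg_smul, ← h, neg_nonneg] at h1
  rw [le_antisymm h1 (star_mul_self_nonneg a)] at h
  exact hr.ne ((smul_eq_zero.1 h.symm).resolve_right hq0)

/-- For `a = p * b * q` the element `star a * a` is a positive multiple of `q`, so a rescaling `u`
of `a` has `star u * u = q`. Then `u * star u` is a nonzero idempotent multiple of `p`, hence `p`
itself. -/
theorem mvnEquiv_of_ne_zero {p q b : B} (hp : IsStarProjection p) (hq : IsStarProjection q)
    (hp1 : ∀ b, ∃ c : ℂ, p * b * p = c • p) (hq1 : ∀ b, ∃ c : ℂ, q * b * q = c • q)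
    (hb : p * b * q ≠ 0) : MvNEquiv p q := by
  have hpp := hp.isIdempotentElem.eq
  have hqq := hq.isIdempotentElem.eq
  have hps := hp.isSelfAdjoint.star_eq
  have hqs := hq.isSelfAdjoint.star_eq
  set a := p * b * q with ha
  have hpa : p * a = a := by rw [ha, ← mul_assoc, ← mul_assoc, hpp]
  have haq : a * q = a := by rw [ha, mul_assoc, hqq]
  clear_value a
  have hsaq : q * star a = star a := by rw [← hqs, ← star_mul, haq]
  have hsap : star a * p = star a := by rw [← hps, ← star_mul, hpa]
  have haa : star a * a ≠ 0 := by rwa [Ne, CStarRing.star_mul_self_eq_zero_iff]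
  obtain ⟨c, hc⟩ := hq1 (star a * a)
  have hc' : star a * a = c • q := by rw [← hc, ← mul_assoc q, hsaq, mul_assoc, haq]
  have hq0 : q ≠ 0 := by rintro rfl; rw [smul_zero] at hc'; exact haa hc'
  obtain ⟨r, hr0, rfl⟩ := nonneg_of_star_mul_self_eq_smul hq hq0 hc'
  rw [Complex.coe_smul] at hc'
  have hr : 0 < r := hr0.lt_of_ne (by rintro rfl; rw [zero_smul] at hc'; exact haa hc')
  set s : ℝ := (Real.sqrt r)⁻¹ with hs
  have hss : s * s * r = 1 := by
    rw [hs, ← mul_inv, Real.mul_self_sqrt hr.le, inv_mul_cancel₀ hr.ne']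
  set u := s • a with hu
  have huu : star u * u = q := by
    rw [hu, star_smul, star_trivial, smul_mul_smul_comm, hc', smul_smul, hss, one_smul]
  have hpu : p * u = u := by rw [hu, mul_smul_comm, hpa]
  have huq : u * q = u := by rw [hu, smul_mul_assoc, haq]
  have hup : star u * p = star u := by rw [← hps, ← star_mul, hpu]
  obtain ⟨d, hd⟩ := hp1 (u * star u)
  have hd' : u * star u = d • p := by rw [← hd, ← mul_assoc, hpu, mul_assoc, hup]
  have hu0 : u * star u ≠ 0 := by
    rw [Ne, CStarRing.mul_star_self_eq_zero_iff]
    rintro h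
    rw [h, mul_zero] at huu
    exact hq0 huu.symm
  have hp0 : p ≠ 0 := by rintro rfl; rw [smul_zero] at hd'; exact hu0 hd'
  have hd0 : d ≠ 0 := by rintro rfl; rw [zero_smul] at hd'; exact hu0 hd'
  have hdd : d * d = d := by
    have h1 : (u * star u) * (u * star u) = u * star u := by
      rw [mul_assoc, ← mul_assoc (star u), huu, ← mul_assoc, huq]
    rw [hd', smul_mul_smul_comm, hpp] at h1
    exact smul_left_injective ℂ hp0 h1
  have hd1 : d = 1 := mul_right_cancel₀ hd0 (by rw [hdd, one_mul])
  exact ⟨u, huu, by rw [hd', hd1, one_smul], hpu, huq⟩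

/-- A finite-dimensional C*-algebra is isomorphic to a multi-matrix algebra. -/
theorem exists_starAlgEquiv_multiMatrix (B : Type*) [CStarAlgebra B] [FiniteDimensional ℂ B] :
    ∃ (k : ℕ) (n : Fin k → ℕ+), Nonempty (B ≃⋆ₐ[ℂ] MultiMatrix n) := by
  classical
  obtain ⟨r, p, hp, hp0, hpp, hsum, hmin⟩ := exists_minimal_projections B
  have hscal : ∀ i b, ∃ c : ℂ, p i * b * p i = c • p i := fun i =>
    exists_smul_of_minimal (hp i) (hmin i)
  have hidem : ∀ i, p i * p i = p i := fun i => (hp i).isIdempotentElem.eq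
  have hstar : ∀ i, star (p i) = p i := fun i => (hp i).isSelfAdjoint.star_eq
  -- Equivalence classes of minimal projections will be the simple summands, and the size of a class
  -- the size of the matrix block. Partial isometries to one representative `o c` per class produce
  -- the matrix units.
  let R : Setoid (Fin r) :=
    { r := fun i j => MvNEquiv (p i) (p j)
      iseqv :=
        { refl := fun i => ⟨p i, by rw [hstar, hidem], by rw [hstar, hidem], hidem i, hidem i⟩
          symm := by
            rintro i j ⟨u, h1, h2, h3, h4⟩
            refine ⟨star u, by rwa [star_star], by rwa [star_star], ?_, ?_⟩
            · rw [← hstar j, ← star_mul, h4]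
            · rw [← hstar i, ← star_mul, h3]
          trans := by
            rintro i j l ⟨u, h1, h2, h3, h4⟩ ⟨v, h1', h2', h3', h4'⟩
            refine ⟨u * v, ?_, ?_, ?_, ?_⟩
            · rw [star_mul, mul_assoc, ← mul_assoc _ u, h1, h3', h1']
            · rw [star_mul, mul_assoc, ← mul_assoc v, h2', ← mul_assoc, h4, h2]
            · rw [← mul_assoc, h3]
            · rw [mul_assoc, h4'] } }
  let Q := Quotient R
  let eQ : Fin (Fintype.card Q) ≃ Q := (Fintype.equivFin Q).symm
  let fib : Fin (Fintype.card Q) → Type := fun c => {i : Fin r // (⟦i⟧ : Q) = eQ c}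
  let n : Fin (Fintype.card Q) → ℕ+ := fun c =>
    ⟨Fintype.card (fib c), Fintype.card_pos_iff.2 ⟨⟨(eQ c).out, Quotient.out_eq _⟩⟩⟩
  let f : ∀ c, Fin (n c) ≃ fib c := fun c => (Fintype.equivFin (fib c)).symm
  let o : Fin (Fintype.card Q) → Fin r := fun c => (eQ c).out
  have hR : ∀ c a, MvNEquiv (p (f c a).1) (p (o c)) := fun c a =>
    Quotient.exact (s := R) ((f c a).2.trans (Quotient.out_eq (eQ c)).symm)
  choose u hu1 hu2 hu3 hu4 using hR
  have hu3' : ∀ c a, star (u c a) * p (f c a).1 = star (u c a) := fun c a => by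
    rw [← hstar, ← star_mul, hu3]
  have hu4' : ∀ c a, p (o c) * star (u c a) = star (u c a) := fun c a => by
    rw [← hstar (o c), ← star_mul, hu4]
  have horth : ∀ c d a b, (f c a).1 ≠ (f d b).1 → star (u c a) * u d b = 0 := fun c d a b h => by
    rw [← hu3' c a, ← hu3 d b, mul_assoc, ← mul_assoc (p _), hpp _ _ h, zero_mul, mul_zero]
  have he := isMatrixUnitSystem_of_partialIsometries (n := n) (p := fun c => p (o c)) (u := u)
    hu1 hu4
    (fun c a b hab => horth c c a b fun h => hab ((f c).injective (Subtype.ext h)))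
    (fun c d a b hcd => horth c d a b fun h => hcd (eQ.injective (by
      rw [← (f c a).2, ← (f d b).2, h])))
    (by
      simp only [hu2]
      calc ∑ c, ∑ a, p (f c a).1 = ∑ c, ∑ i : fib c, p i.1 :=
            Finset.sum_congr rfl fun c _ => Equiv.sum_comp (f c) fun i => p i.1
        _ = ∑ q : Q, ∑ i : {i : Fin r // (⟦i⟧ : Q) = q}, p i.1 :=
            Equiv.sum_comp eQ fun q => ∑ i : {i : Fin r // (⟦i⟧ : Q) = q}, p i.1
        _ = ∑ i, p i := Fintype.sum_fiberwise _ _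
        _ = 1 := hsum)
  refine ⟨_, n, ⟨(StarAlgEquiv.ofBijective he.hom ⟨he.hom_injective ?_, fun b => ?_⟩).symm⟩⟩
  · intro c a
    rw [hu2]
    exact hp0 _
  · change b ∈ he.hom.range
    -- Surjectivity is checked corner by corner: a nonzero corner forces `p i` and `p j` into one
    -- class, and is then spanned by a single matrix unit.
    have hb : b = ∑ i, ∑ j, p i * b * p j := by
      simp only [← Finset.mul_sum, ← Finset.sum_mul, hsum, one_mul, mul_one]
    rw [hb]
    refine sum_mem fun i _ => sum_mem fun j _ => ?_
    by_cases h0 : p i * b * p j = 0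
    · rw [h0]; exact zero_mem _
    have hij : MvNEquiv (p i) (p j) :=
      mvnEquiv_of_ne_zero (hp i) (hp j) (hscal i) (hscal j) h0
    obtain ⟨c, hc⟩ := eQ.surjective ⟦i⟧
    have hcj : eQ c = ⟦j⟧ := hc.trans (Quotient.sound (s := R) hij)
    obtain ⟨a, ha⟩ := (f c).surjective ⟨i, hc.symm⟩
    obtain ⟨a', ha'⟩ := (f c).surjective ⟨j, hcj.symm⟩
    obtain ⟨t, ht⟩ := hscal (o c) (star (u c a) * b * u c a')
    have hi : p i = u c a * star (u c a) := by rw [hu2, ha]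
    have hj : p j = u c a' * star (u c a') := by rw [hu2, ha']
    have ht' : star (u c a) * b * u c a' = t • p (o c) := by
      rw [← ht, mul_assoc (p _), mul_assoc (_ * b), hu4, ← mul_assoc (p _), ← mul_assoc (p _), hu4']
    refine ⟨t • matrixUnit n c a a', ?_⟩
    change he.hom (t • matrixUnit n c a a') = _
    rw [map_smul, he.hom_matrixUnit, hi, hj]
    calc t • (u c a * star (u c a')) = u c a * (t • p (o c)) * star (u c a') := by
          rw [mul_smul_comm, hu4, smul_mul_assoc]
      _ = _ := by rw [← ht']; simp only [mul_assoc]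

end Structure
end

noncomputable section

/-! ### Existence of continuous sections -/

section SectionsExist

variable {X : Type*} [TopologicalSpace X] {A : X → Type*} [∀ x, CStarAlgebra (A x)]
  [TopologicalSpace (Tot A)]

/-- Near `x` the values of `s` are within `ε` of points of the total space that converge to `b`. -/
def IsNearAt (s : ∀ x, A x) (x : X) (b : A x) (ε : ℝ) : Prop :=
  ∀ W ∈ 𝓝 (⟨x, b⟩ : Tot A), ∀ᶠ y in 𝓝 x, ∃ w : A y, (⟨y, w⟩ : Tot A) ∈ W ∧ ‖s y - w‖ ≤ ε

namespace IsNearAt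

variable {s t : ∀ x, A x} {x : X} {b : A x} {ε δ : ℝ}

theorem mono (h : IsNearAt s x b ε) (hεδ : ε ≤ δ) : IsNearAt s x b δ := fun W hW =>
  (h W hW).mono fun _ ⟨w, hw, hw'⟩ => ⟨w, hw, hw'.trans hεδ⟩

theorem congr (h : IsNearAt s x b ε) (hst : ∀ᶠ y in 𝓝 x, s y = t y) : IsNearAt t x b ε :=
  fun W hW => ((h W hW).and hst).mono fun _ ⟨⟨w, hw, hw'⟩, he⟩ => ⟨w, hw, he ▸ hw'⟩

theorem of_continuous (hs : Continuous fun x => (⟨x, s x⟩ : Tot A)) :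
    IsNearAt s x (s x) 0 := fun _ hW =>
  (hs.continuousAt.eventually hW).mono fun y hy => ⟨s y, hy, by simp⟩

theorem of_dist (hs : IsNearAt s x b ε) (h : ∀ y, ‖t y - s y‖ ≤ δ) :
    IsNearAt t x b (ε + δ) := by
  intro W hW
  filter_upwards [hs W hW] with y ⟨w, hw, hw'⟩
  refine ⟨w, hw, ?_⟩
  rw [← sub_add_sub_cancel (t y) (s y) w, add_comm ε]
  exact (norm_add_le _ _).trans (add_le_add (h y) hw')

end IsNearAt

variable [hA : IsUnitalFCStarBundle A]

theorem continuous_norm_sub_fibre :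
    Continuous fun p : FibreSquare A => ‖p.snd.1 - p.snd.2‖ := by
  have hi : Continuous fun p : FibreSquare A =>
    ((⟨p.1, p.2.1⟩ : Tot A), (⟨p.1, p.2.2⟩ : Tot A)) := continuous_induced_dom
  have h1 : Continuous fun p : FibreSquare A => (⟨p.1, p.2.1⟩ : Tot A) := continuous_fst.comp hi
  have h2 : Continuous fun p : FibreSquare A => (⟨p.1, p.2.2⟩ : Tot A) := continuous_snd.comp hi
  have h3 : Continuous fun p : FibreSquare A => (⟨p.1, (-1 : ℂ) • p.2.2⟩ : Tot A) :=
    hA.continuous_smul.comp (continuous_const.prodMk h2)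
  have h4 : Continuous fun p : FibreSquare A =>
      (⟨p.1, (p.2.1, (-1 : ℂ) • p.2.2)⟩ : FibreSquare A) :=
    continuous_induced_rng.2 (h1.prodMk h3)
  have h5 := hA.continuous_norm.comp (hA.continuous_add.comp h4)
  refine h5.congr fun p => ?_
  simp [sub_eq_add_neg]

/-- Every point of the total space has neighbourhoods with small fibres. -/
theorem exists_thin_nhds (x : X) (b : A x) {ε : ℝ} (hε : 0 < ε) :
    ∃ W : Set (Tot A), IsOpen W ∧ (⟨x, b⟩ : Tot A) ∈ W ∧
      ∀ y (w w' : A y), (⟨y, w⟩ : Tot A) ∈ W → (⟨y, w'⟩ : Tot A) ∈ W → ‖w - w'‖ < ε := by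
  have h : {p : FibreSquare A | ‖p.snd.1 - p.snd.2‖ < ε} ∈
      𝓝 (⟨x, (b, b)⟩ : FibreSquare A) :=
    (isOpen_lt continuous_norm_sub_fibre continuous_const).mem_nhds (by simpa using hε)
  rw [mem_nhds_induced] at h
  obtain ⟨S, hS, hSW⟩ := h
  rw [mem_nhds_prod_iff'] at hS
  obtain ⟨W₁, W₂, h1, hb1, h2, hb2, hW⟩ := hS
  refine ⟨W₁ ∩ W₂, h1.inter h2, ⟨hb1, hb2⟩, fun y w w' hw hw' => ?_⟩
  have hm : ((⟨y, w⟩, ⟨y, w'⟩) : Tot A × Tot A) ∈ S := hW ⟨hw.1, hw'.2⟩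
  exact @hSW (⟨y, (w, w')⟩ : FibreSquare A) hm

theorem continuous_zero_section : Continuous fun x => (⟨x, 0⟩ : Tot A) := by
  simpa using continuous_section_smul (f := fun _ => (0 : ℂ)) continuous_const hA.continuous_one

namespace IsNearAt

variable {s t : ∀ x, A x} {x : X} {b c : A x} {ε δ : ℝ}

theorem add (hs : IsNearAt s x b ε) (ht : IsNearAt t x c δ) :
    IsNearAt (fun y => s y + t y) x (b + c) (ε + δ) := by
  intro W hW
  have h1 := hA.continuous_add.continuousAt (x := (⟨x, (b, c)⟩ : FibreSquare A)) hW
  rw [Filter.mem_map, mem_nhds_induced] at h1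
  obtain ⟨S, hS, hSW⟩ := h1
  rw [mem_nhds_prod_iff] at hS
  obtain ⟨W₁, h1, W₂, h2, hS⟩ := hS
  filter_upwards [hs W₁ h1, ht W₂ h2] with y ⟨w, hw, hw'⟩ ⟨v, hv, hv'⟩
  have hm : ((⟨y, w⟩, ⟨y, v⟩) : Tot A × Tot A) ∈ S := hS ⟨hw, hv⟩
  refine ⟨w + v, @hSW (⟨y, (w, v)⟩ : FibreSquare A) hm, ?_⟩
  rw [add_sub_add_comm]
  exact (norm_add_le _ _).trans (add_le_add hw' hv')

theorem smul (hs : IsNearAt s x b ε) {f : X → ℂ} (hf : Continuous f) (hδ : ‖f x‖ * ε < δ) :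
    IsNearAt (fun y => f y • s y) x (f x • b) δ := by
  intro W hW
  have h1 := hA.continuous_smul.continuousAt (x := (f x, (⟨x, b⟩ : Tot A))) hW
  rw [Filter.mem_map, mem_nhds_prod_iff] at h1
  obtain ⟨D, hD, W', hW', hDW⟩ := h1
  have h2 : ∀ᶠ y in 𝓝 x, ‖f y‖ * ε < δ :=
    (hf.norm.mul continuous_const).continuousAt.eventually_lt continuousAt_const hδ
  filter_upwards [hs W' hW', hf.continuousAt hD, h2] with y ⟨w, hw, hw'⟩ hy hy'
  refine ⟨f y • w, @hDW (f y, ⟨y, w⟩) ⟨hy, hw⟩, ?_⟩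
  rw [← smul_sub, norm_smul]
  exact (mul_le_mul_of_nonneg_left hw' (norm_nonneg _)).trans hy'.le

/-- Since the projection is open, every neighbourhood of `b` has points over all base points near
`x`, and they may be taken of norm less than `ε`. Adding this zero section is how a base value is
moved in `change_base`. -/
theorem zero_of_norm_lt (h : ‖b‖ < ε) : IsNearAt (fun _ => 0) x b ε := by
  intro W hW
  have h1 : W ∩ {p : Tot A | ‖p.snd‖ < ε} ∈ 𝓝 (⟨x, b⟩ : Tot A) :=
    inter_mem hW ((isOpen_lt hA.continuous_norm continuous_const).mem_nhds h)
  filter_upwards [hA.isOpenMap_proj.image_mem_nhds h1] with y hy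
  obtain ⟨⟨z, w⟩, hw, rfl⟩ := hy
  refine ⟨w, hw.1, ?_⟩
  rw [zero_sub, norm_neg]
  exact le_of_lt hw.2

theorem change_base (hs : IsNearAt s x b ε) (h : ‖c - b‖ < δ) : IsNearAt s x c (ε + δ) := by
  have := hs.add (zero_of_norm_lt h)
  simpa using this

theorem eventually_norm_sub_lt (hs : IsNearAt s x b ε) (ht : IsNearAt t x b δ) {η : ℝ}
    (hη : ε + δ < η) : ∀ᶠ y in 𝓝 x, ‖s y - t y‖ < η := by
  obtain ⟨W, hWo, hbW, hW⟩ := exists_thin_nhds x b (sub_pos.2 hη)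
  filter_upwards [hs W (hWo.mem_nhds hbW), ht W (hWo.mem_nhds hbW)] with y ⟨w, hw, hw'⟩ ⟨v, hv, hv'⟩
  have h1 := hW y w v hw hv
  calc ‖s y - t y‖ = ‖(s y - w) + (w - v) - (t y - v)‖ := by congr 1; abel
    _ ≤ ‖(s y - w)‖ + ‖(w - v)‖ + ‖(t y - v)‖ :=
        (norm_sub_le _ _).trans (add_le_add_left (norm_add_le _ _) _)
    _ < η := by linarith

end IsNearAt

theorem continuous_of_isNearAt {s : ∀ x, A x}
    (hs : ∀ x, ∀ ε > 0, IsNearAt s x (s x) ε) : Continuous fun x => (⟨x, s x⟩ : Tot A) := by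
  refine continuous_iff_continuousAt.2 fun x W hW => ?_
  obtain ⟨ε, hε, V, hV, W', hW', h⟩ := exists_add_mem (s x) hW
  rw [Filter.mem_map]
  filter_upwards [hs x (ε / 2) (half_pos hε) W' hW', hV] with y ⟨w, hw, hw'⟩ hyV
  have := h y hyV (s y - w) w (hw'.trans_lt (half_lt_self hε)) hw
  rwa [sub_add_cancel] at this

/-- An arbitrary selection of points from a neighbourhood of `b` with thin fibres is `ε`-near its
own value everywhere over the projection of that neighbourhood, which is open. -/
theorem exists_isNearAt_local (x : X) (b : A x) {ε : ℝ} (hε : 0 < ε) :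
    ∃ (t : ∀ x, A x) (V : Set X), IsOpen V ∧ x ∈ V ∧ t x = b ∧
      ∀ y ∈ V, IsNearAt t y (t y) ε := by
  classical
  obtain ⟨W, hWo, hbW, hW⟩ := exists_thin_nhds x b hε
  have h : ∀ y, ∃ a : A y, y ∈ (fun p : Tot A => p.proj) '' W → (⟨y, a⟩ : Tot A) ∈ W := by
    intro y
    by_cases hy : y ∈ (fun p : Tot A => p.proj) '' W
    · obtain ⟨⟨z, w⟩, hw, rfl⟩ := hy
      exact ⟨w, fun _ => hw⟩
    · exact ⟨0, fun h => (hy h).elim⟩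
  choose t₀ ht₀ using h
  set t := Function.update t₀ x b with ht
  have htW : ∀ y ∈ (fun p : Tot A => p.proj) '' W, (⟨y, t y⟩ : Tot A) ∈ W := by
    intro y hy
    by_cases hyx : y = x
    · subst hyx; rwa [ht, Function.update_self]
    · rw [ht, Function.update_of_ne hyx]; exact ht₀ y hy
  refine ⟨t, _, hA.isOpenMap_proj W hWo, ⟨_, hbW, rfl⟩, Function.update_self .., fun y hy => ?_⟩
  intro W' hW'
  have hWW : W' ∩ W ∈ 𝓝 (⟨y, t y⟩ : Tot A) := inter_mem hW' (hWo.mem_nhds (htW y hy))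
  filter_upwards [hA.isOpenMap_proj.image_mem_nhds hWW] with z hz
  obtain ⟨⟨z, w⟩, hw, rfl⟩ := hz
  exact ⟨w, hw.1, (hW z _ w (htW z ⟨_, hw.2, rfl⟩) hw.2).le⟩

variable [CompactSpace X] [T2Space X]

/-- Glueing of approximately continuous local sections with a partition of unity. -/
theorem exists_isNearAt_glue {ε : ℝ} (hε : 0 < ε) (s : ∀ x, A x) (C : X → ℝ)
    (t : X → ∀ x, A x) (V : X → Set X) (hVo : ∀ x, IsOpen (V x)) (hxV : ∀ x, x ∈ V x)
    (ht : ∀ x, ∀ y ∈ V x, IsNearAt (t x) y (t x y) ε)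
    (hst : ∀ x, ∀ y ∈ V x, ‖t x y - s y‖ ≤ C y) :
    ∃ s' : ∀ x, A x, (∀ x, IsNearAt s' x (s' x) (2 * ε)) ∧ ∀ x, ‖s' x - s x‖ ≤ C x := by
  classical
  obtain ⟨F, hF⟩ := CompactSpace.elim_nhds_subcover V fun x => (hVo x).mem_nhds (hxV x)
  obtain ⟨φ, hφ⟩ := PartitionOfUnity.exists_isSubordinate_of_locallyFinite (ι := F)
    (s := (Set.univ : Set X)) isClosed_univ (fun i => V i) (fun i => hVo i)
    (locallyFinite_of_finite _) (by
      intro x _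
      have : x ∈ ⋃ x ∈ F, V x := hF ▸ Set.mem_univ x
      simpa using this)
  have hsum : ∀ x, ∑ i, φ i x = 1 := fun x => by
    rw [← finsum_eq_sum_of_fintype]; exact φ.sum_eq_one (Set.mem_univ x)
  have hnn : ∀ i x, 0 ≤ φ i x := fun i x => φ.nonneg i x
  have hV : ∀ i x, φ i x ≠ 0 → x ∈ V i := fun i x h => hφ i (subset_tsupport _ h)
  refine ⟨fun x => ∑ i, (φ i x : ℂ) • t i x, fun x => ?_, fun x => ?_⟩
  -- `IsNearAt.smul` needs a strict inequality, so each term gets slack `η`; the slacks add up to at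
  -- most `ε`, whence the bound `2 * ε`.
  · set η : ℝ := ε / (Fintype.card F + 1) with hη
    have hη0 : 0 < η := by positivity
    have hterm : ∀ i : F, IsNearAt (fun y => (φ i y : ℂ) • t i y) x ((φ i x : ℂ) • t i x)
        (φ i x * ε + η) := by
      intro i
      -- Nothing is known about `t i` off `V i`, but off the closed support the term is locally
      -- zero.
      by_cases hx : x ∈ tsupport (φ i)
      · refine (ht i x (hφ i hx)).smul (by fun_prop) ?_
        rw [Complex.norm_real, Real.norm_of_nonneg (hnn i x)]
        linarith
      · have hev : ∀ᶠ y in 𝓝 x, φ i y = 0 := by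
          filter_upwards [(isClosed_tsupport _).isOpen_compl.mem_nhds hx] with y hy
          exact image_eq_zero_of_notMem_tsupport hy
        have h0 := (IsNearAt.of_continuous (x := x) (continuous_zero_section (A := A))).mono
          (show 0 ≤ φ i x * ε + η from by have := hnn i x; positivity)
        rw [hev.self_of_nhds]
        rw [hev.self_of_nhds] at h0
        simpa using h0.congr (t := fun y => (φ i y : ℂ) • t i y)
          (hev.mono fun y hy => by simp [hy])
    have hfin : ∀ I : Finset F, IsNearAt (fun y => ∑ i ∈ I, (φ i y : ℂ) • t i y) x
        (∑ i ∈ I, (φ i x : ℂ) • t i x) (∑ i ∈ I, (φ i x * ε + η)) := by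
      intro I
      induction I using Finset.induction_on with
      | empty => simpa using IsNearAt.of_continuous (x := x) (continuous_zero_section (A := A))
      | insert i I hi ih =>
        simp only [Finset.sum_insert hi]
        exact (hterm i).add ih
    refine (hfin Finset.univ).mono ?_
    rw [Finset.sum_add_distrib, ← Finset.sum_mul, hsum, Finset.sum_const, nsmul_eq_mul,
      Finset.card_univ, hη]
    have : (Fintype.card F : ℝ) * (ε / (Fintype.card F + 1)) ≤ ε := by
      rw [mul_div_assoc', div_le_iff₀ (by positivity)]
      nlinarith
    linarith
  · have h1 : (∑ i, (φ i x : ℂ) • t i x) - s x = ∑ i, (φ i x : ℂ) • (t i x - s x) := by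
      simp only [smul_sub, Finset.sum_sub_distrib]
      rw [← Finset.sum_smul, ← Complex.ofReal_sum, hsum, Complex.ofReal_one, one_smul]
    rw [h1]
    calc ‖∑ i, (φ i x : ℂ) • (t i x - s x)‖ ≤ ∑ i, φ i x * C x := by
          refine (norm_sum_le _ _).trans (Finset.sum_le_sum fun i _ => ?_)
          rw [norm_smul, Complex.norm_real, Real.norm_of_nonneg (hnn i x)]
          by_cases h0 : φ i x = 0
          · simp [h0]
          · exact mul_le_mul_of_nonneg_left (hst i x (hV i x h0)) (hnn i x)
      _ = C x := by rw [← Finset.sum_mul, hsum, one_mul]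

/-- Near `x` a local `ε / 4`-near section through `s x` stays within `2 * ε` of `s`, as `ε / 4 + ε <
2 * ε`. Glueing doubles `ε / 4` to `ε / 2`, while convexity preserves the distance to `s`. -/
theorem exists_isNearAt_improve {ε : ℝ} (hε : 0 < ε) (s : ∀ x, A x)
    (hs : ∀ x, IsNearAt s x (s x) ε) :
    ∃ s' : ∀ x, A x, (∀ x, IsNearAt s' x (s' x) (ε / 2)) ∧ ∀ x, ‖s' x - s x‖ ≤ 2 * ε := by
  have h : ∀ x, ∃ (t : ∀ x, A x) (V : Set X), IsOpen V ∧ x ∈ V ∧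
      (∀ y ∈ V, IsNearAt t y (t y) (ε / 4)) ∧ ∀ y ∈ V, ‖t y - s y‖ ≤ 2 * ε := by
    intro x
    obtain ⟨t, V, hV, hxV, htx, ht⟩ := exists_isNearAt_local x (s x) (show 0 < ε / 4 by linarith)
    have h1 : IsNearAt t x (s x) (ε / 4) := htx ▸ ht x hxV
    have h2 := h1.eventually_norm_sub_lt (hs x) (show ε / 4 + ε < 2 * ε by linarith)
    obtain ⟨V', hV', hVo', hxV'⟩ := eventually_nhds_iff.1 h2
    exact ⟨t, V ∩ V', hV.inter hVo', ⟨hxV, hxV'⟩, fun y hy => ht y hy.1,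
      fun y hy => (hV' y hy.2).le⟩
  choose t V hVo hxV ht hst using h
  obtain ⟨s', h1, h2⟩ := exists_isNearAt_glue (show 0 < ε / 4 by linarith) s (fun _ => 2 * ε) t V
    hVo hxV ht hst
  exact ⟨s', fun x => (h1 x).mono (by linarith), h2⟩

theorem exists_isNearAt_global (x : X) (b : A x) {ε : ℝ} (hε : 0 < ε) :
    ∃ s : ∀ x, A x, (∀ y, IsNearAt s y (s y) ε) ∧ s x = b := by
  classical
  obtain ⟨t, V, hV, hxV, htx, ht⟩ := exists_isNearAt_local x b (show 0 < ε / 2 by linarith)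
  -- The section `t` near `x` is glued with the zero section off `x`. The distance bound vanishes at
  -- `x`, which keeps the value `b` there.
  obtain ⟨s, h1, h2⟩ := exists_isNearAt_glue (show 0 < ε / 2 by linarith) t
    (fun y => if y = x then 0 else ‖t y‖) (fun z => if z = x then t else fun _ => 0)
    (fun z => if z = x then V else {x}ᶜ)
    (fun z => by split_ifs; exacts [hV, isOpen_compl_singleton])
    (fun z => by split_ifs with h; exacts [h ▸ hxV, h])
    (fun z y hy => by
      split_ifs at hy ⊢ with h
      · exact ht y hy
      · exact (IsNearAt.of_continuous (x := y) (continuous_zero_section (A := A))).mono (by linarith))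
    (fun z y hy => by
      by_cases hz : z = x
      · simp only [hz, if_true, sub_self, norm_zero]
        split_ifs
        exacts [le_rfl, norm_nonneg _]
      · simp only [hz, if_false] at hy ⊢
        rw [if_neg (show y ≠ x from hy)]
        simp)
  refine ⟨s, fun y => (h1 y).mono (by linarith), ?_⟩
  have := h2 x
  rw [if_pos rfl, norm_le_zero_iff, sub_eq_zero, htx] at this
  exact this

/-- Iterated improvement gives a sequence that is uniformly Cauchy at a geometric rate; its limit is
near its own values for every tolerance, hence continuous. -/
theorem exists_continuous_section_near (x : X) (b : A x) {ε : ℝ} (hε : 0 < ε) :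
    ∃ s : ∀ x, A x, (Continuous fun x => (⟨x, s x⟩ : Tot A)) ∧ ‖s x - b‖ ≤ 4 * ε := by
  obtain ⟨s₀, hs₀, hs₀x⟩ := exists_isNearAt_global x b hε
  have himp : ∀ (n : ℕ) (s : {s : ∀ x, A x // ∀ x, IsNearAt s x (s x) (ε / 2 ^ n)}),
      ∃ s' : {s : ∀ x, A x // ∀ x, IsNearAt s x (s x) (ε / 2 ^ (n + 1))},
        ∀ x, ‖s'.1 x - s.1 x‖ ≤ 2 * (ε / 2 ^ n) := by
    intro n s
    obtain ⟨s', h1, h2⟩ := exists_isNearAt_improve (by positivity) s.1 s.2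
    exact ⟨⟨s', fun x => (h1 x).mono (by rw [pow_succ, div_div])⟩, h2⟩
  choose imp himp using himp
  let S : ∀ n : ℕ, {s : ∀ x, A x // ∀ x, IsNearAt s x (s x) (ε / 2 ^ n)} := fun n =>
    Nat.rec ⟨s₀, fun x => by simpa using hs₀ x⟩ (fun n s => imp n s) n
  have hS : ∀ n y, dist ((S n).1 y) ((S (n + 1)).1 y) ≤ 4 * ε / 2 / 2 ^ n := by
    intro n y
    rw [dist_comm, dist_eq_norm]
    refine (himp n (S n) y).trans (le_of_eq ?_)
    ring
  choose s hs using fun y => cauchySeq_tendsto_of_complete (cauchySeq_of_le_geometric_two (hS · y))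
  have hdist : ∀ n y, ‖s y - (S n).1 y‖ ≤ 4 * ε / 2 ^ n := fun n y => by
    rw [← dist_eq_norm, dist_comm]
    exact dist_le_of_le_geometric_two_of_tendsto (hS · y) (hs y) n
  refine ⟨s, continuous_of_isNearAt fun y δ hδ => ?_, ?_⟩
  -- In units of `ε / 2 ^ n`, 10 = 1 + 4 + 5: nearness of `S n`, distance from `S n` to the limit,
  -- and change of base value, where 5 replaces 4 for strictness.
  · have hlim : Tendsto (fun n : ℕ => 10 * ε / 2 ^ n) atTop (𝓝 0) :=
      tendsto_const_nhds.div_atTop (tendsto_pow_atTop_atTop_of_one_lt one_lt_two)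
    obtain ⟨n, hn⟩ := (hlim.eventually_lt_const hδ).exists
    have hlt : ‖s y - (S n).1 y‖ < 5 * ε / 2 ^ n :=
      (hdist n y).trans_lt (by gcongr; norm_num)
    refine (((S n).2 y).of_dist (hdist n)).change_base hlt |>.mono ?_
    refine le_trans (le_of_eq ?_) hn.le
    ring
  · have h0 := hdist 0 x
    have : (S 0).1 x = b := hs₀x
    rwa [this, pow_zero, div_one] at h0

/-- Over a compact Hausdorff space every point of a bundle with finite-dimensional fibres lies on
a continuous section. -/
theorem exists_section_apply_eq [∀ x, Nontrivial (A x)] (x : X) [FiniteDimensional ℂ (A x)]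
    (b : A x) : ∃ s : Sections A, s.1 x = b := by
  let ev : Sections A →ₗ[ℂ] A x :=
    { toFun := fun s => s.1 x, map_add' := fun _ _ => rfl, map_smul' := fun _ _ => rfl }
  have hdense : Dense (LinearMap.range ev : Set (A x)) := by
    intro b
    rw [Metric.mem_closure_iff]
    intro ε hε
    obtain ⟨s, hs, hsb⟩ := exists_continuous_section_near x b (show 0 < ε / 8 by linarith)
    have hbdd : Memℓp s ∞ := by
      rw [memℓp_infty_iff]
      exact (isCompact_range (hA.continuous_norm.comp hs)).bddAbove
    refine ⟨s x, ⟨⟨⟨s, hbdd⟩, hs⟩, rfl⟩, ?_⟩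
    rw [dist_comm, dist_eq_norm]
    linarith
  have hclosed : IsClosed (LinearMap.range ev : Set (A x)) := Submodule.closed_of_finiteDimensional _
  have : b ∈ (LinearMap.range ev : Set (A x)) := by
    rw [← hclosed.closure_eq]; exact hdense b
  exact this

end SectionsExist
end

noncomputable section

/-! ### Local extensions of the fibres -/

section Polar

variable {B : Type*} [CStarAlgebra B]

/-- A continuous function on the line that agrees with `t ↦ t ^ (-1/2)` for `t ≥ 1/2`. -/
def invSqrtCutoff (t : ℝ) : ℝ := (Real.sqrt (max t (1 / 2)))⁻¹

theorem continuous_invSqrtCutoff : Continuous invSqrtCutoff := by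
  refine Continuous.inv₀ (by fun_prop) fun t => ?_
  have : 0 < max t (1 / 2) := lt_max_of_lt_right (by norm_num)
  exact (Real.sqrt_pos.2 this).ne'

theorem invSqrtCutoff_one : invSqrtCutoff 1 = 1 := by
  rw [invSqrtCutoff, max_eq_left (by norm_num)]; simp

/-- The partial isometry in the polar decomposition of an element close to a partial isometry. -/
theorem polar_partialIsometry {p q w : B} (hp : IsStarProjection p) (hq : IsStarProjection q)
    (hwp : w * p = w) (hqw : q * w = w) (hb : ‖(star w * w + 1 - p) - 1‖ < 1 / 2) {u : B}
    (hu : u = w * cfc invSqrtCutoff (star w * w + 1 - p)) (huq : ‖q - u * star u‖ < 1) :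
    star u * u = p ∧ u * star u = q ∧ q * u = u ∧ u * p = u := by
  have hpp := hp.isIdempotentElem.eq
  have hps := hp.isSelfAdjoint.star_eq
  have hqq := hq.isIdempotentElem.eq
  have hpw : p * star w = star w := by rw [← hps, ← star_mul, hwp]
  set b := star w * w + 1 - p with hbdef
  have hbs : IsSelfAdjoint b := by
    rw [IsSelfAdjoint, hbdef]
    simp [hps]
  have hbp : b * p = star w * w := by
    rw [hbdef, sub_mul, add_mul, mul_assoc, hwp, hpp, one_mul, add_sub_cancel_right]
  have hpb : p * b = star w * w := by
    rw [hbdef, mul_sub, mul_add, ← mul_assoc, hpw, hpp, mul_one, add_sub_cancel_right]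
  set c := cfc invSqrtCutoff b with hc
  have hcs : star c = c := (cfc_predicate invSqrtCutoff b : IsSelfAdjoint c)
  have hcp : c * p = p * c := by
    have h : Commute p b := hpb.trans hbp.symm
    exact (h.symm.cfc_real invSqrtCutoff).eq
  have hcont : ∀ s, ContinuousOn invSqrtCutoff s := fun s => continuous_invSqrtCutoff.continuousOn
  have hspec : ∀ t ∈ spectrum ℝ b, 1 / 2 ≤ t := by
    intro t ht
    rcases subsingleton_or_nontrivial B with hB | hB
    · simp [spectrum.of_subsingleton] at ht
    have h1 : t - 1 ∈ spectrum ℝ (b - algebraMap ℝ B 1) := by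
      rw [← spectrum.sub_singleton_eq]
      exact ⟨t, ht, 1, rfl, rfl⟩
    have h2 := spectrum.norm_le_norm_of_mem h1
    rw [map_one, Real.norm_eq_abs] at h2
    have := abs_lt.1 (h2.trans_lt hb)
    linarith [this.1]
  have hcbc : c * b * c = 1 := by
    rw [hc]
    nth_rw 2 [← cfc_id' ℝ b]
    rw [← cfc_mul _ _ b (hcont _), ← cfc_mul _ _ b _ (hcont _), ← cfc_const_one ℝ b]
    · refine cfc_congr fun t ht => ?_
      have h1 := hspec t ht
      have h0 : 0 < t := by linarith
      simp only [invSqrtCutoff, max_eq_left h1]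
      have := Real.mul_self_sqrt h0.le
      have h2 := (Real.sqrt_pos.2 h0).ne'
      field_simp
      nlinarith
    · exact (hcont _).mul continuousOn_id
  have huu : star u * u = p := by
    calc star u * u = c * (star w * w) * c := by rw [hu, star_mul, hcs]; simp only [mul_assoc]
      _ = c * b * c * p := by rw [← hbp, ← mul_assoc, mul_assoc _ p, ← hcp, ← mul_assoc]
      _ = p := by rw [hcbc, one_mul]
  have hup : u * p = u := by rw [hu, mul_assoc, hcp, ← mul_assoc, hwp]
  have hqu : q * u = u := by rw [hu, ← mul_assoc, hqw]
  have hproj : IsStarProjection (u * star u) :=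
    ⟨by rw [IsIdempotentElem, mul_assoc, ← mul_assoc (star u), huu, ← mul_assoc, hup],
      by rw [IsSelfAdjoint, star_mul, star_star]⟩
  -- `u * star u` is a subprojection of `q`; the difference is a projection of norm less than one,
  -- hence zero.
  have hd : IsStarProjection (q - u * star u) :=
    hproj.sub_of_mul_eq_right hq (by rw [← mul_assoc, hqu])
  refine ⟨huu, ?_, hqu, hup⟩
  by_contra hne
  have := hd.norm_eq_one (sub_ne_zero.2 (Ne.symm hne))
  linarith

end Polar

/-! ### Functional calculus on eigenprojections -/

section EigenCfc

variable {B : Type*} [CStarAlgebra B] [FiniteDimensional ℂ B]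

/-- On a finite spectrum `f t - f ν` is a multiple of `t - ν` by some function, automatically
continuous there, and `h - ν` annihilates `e`. -/
theorem cfc_mul_eq_smul {h e : B} (hh : IsSelfAdjoint h) {ν : ℝ} (he : h * e = ν • e)
    (f : ℝ → ℝ) : cfc f h * e = f ν • e := by
  have hc : ∀ f : ℝ → ℝ, ContinuousOn f (spectrum ℝ h) := fun f =>
    (finite_spectrum_real h).continuousOn f
  have h1 : cfc f h = cfc (fun t => (f t - f ν) / (t - ν)) h * (h - algebraMap ℝ B ν) +
      algebraMap ℝ B (f ν) := by
    have h2 : h - algebraMap ℝ B ν = cfc (fun t => t - ν) h := by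
      rw [cfc_sub _ _ h (hc _) (hc _), cfc_id' ℝ h, cfc_const ν h]
    rw [h2, ← cfc_mul _ _ h (hc _) (hc _), ← cfc_const (f ν) h, ← cfc_add _ _ _ (hc _) (hc _)]
    refine cfc_congr fun t _ => ?_
    by_cases ht : t = ν
    · simp [ht]
    · have : t - ν ≠ 0 := sub_ne_zero.2 ht
      field_simp
      ring
  rw [h1, add_mul, mul_assoc, sub_mul, he, ← Algebra.smul_def, sub_self, mul_zero, zero_add,
    ← Algebra.smul_def]

theorem cfc_sum_smul {I : Type*} [Fintype I] {e : I → B} (he : ∀ i, IsStarProjection (e i))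
    (hee : ∀ i j, i ≠ j → e i * e j = 0) (hsum : ∑ i, e i = 1) (ν : I → ℝ) (f : ℝ → ℝ) :
    cfc f (∑ i, ν i • e i) = ∑ i, f (ν i) • e i := by
  classical
  set h := ∑ i, ν i • e i with hh
  have hs : IsSelfAdjoint h := by
    rw [IsSelfAdjoint, hh, star_sum]
    exact Finset.sum_congr rfl fun i _ => by
      rw [star_smul, star_trivial, (he i).isSelfAdjoint.star_eq]
  have hhe : ∀ i, h * e i = ν i • e i := fun i => by
    rw [hh, Finset.sum_mul, Finset.sum_eq_single i]
    · rw [smul_mul_assoc, (he i).isIdempotentElem.eq]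
    · intro j _ hj; rw [smul_mul_assoc, hee j i hj, smul_zero]
    · simp
  calc cfc f h = cfc f h * ∑ i, e i := by rw [hsum, mul_one]
    _ = _ := by
      rw [Finset.mul_sum]
      exact Finset.sum_congr rfl fun i _ => cfc_mul_eq_smul hs (hhe i) f

end EigenCfc

/-! ### Lifting projections and partial isometries to sections -/

section LocalExtension

variable {X : Type*} [TopologicalSpace X] {A : X → Type*} [∀ x, CStarAlgebra (A x)]
  [∀ x, Nontrivial (A x)] [TopologicalSpace (Tot A)] [hA : IsUnitalFCStarBundle A]

variable (A) in
/-- The evaluation of sections at a point. -/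
def evalSection (x : X) : Sections A →⋆ₐ[ℂ] A x where
  toFun s := s.1 x
  map_one' := rfl
  map_mul' _ _ := rfl
  map_zero' := rfl
  map_add' _ _ := rfl
  commutes' _ := rfl
  map_star' _ := rfl

theorem continuous_evalSection (x : X) : Continuous (evalSection A x) :=
  AddMonoidHomClass.continuous_of_bound (evalSection A x) 1 fun s => by
    rw [one_mul]; exact lp.norm_apply_le_norm ENNReal.top_ne_zero s.1 x

theorem continuous_norm_evalSection (s : Sections A) : Continuous fun x => ‖evalSection A x s‖ :=
  hA.continuous_norm.comp s.2

theorem eventually_norm_evalSection_lt {s : Sections A} {x : X} {ε : ℝ}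
    (h : ‖evalSection A x s‖ < ε) : ∀ᶠ y in 𝓝 x, ‖evalSection A y s‖ < ε :=
  (continuous_norm_evalSection s).continuousAt.eventually_lt continuousAt_const h

/-- Functional calculus taken once in the algebra of sections yields continuous sections, and this
identifies their values fibrewise. -/
theorem evalSection_cfc (x : X) {f : ℝ → ℝ} (hf : Continuous f) {s : Sections A}
    (hs : IsSelfAdjoint s) : evalSection A x (cfc f s) = cfc f (evalSection A x s) :=
  StarAlgHomClass.map_cfc (evalSection A x) f s hf.continuousOn (continuous_evalSection x) hs
    (hs.map (evalSection A x))

/-- Bump functions that are one near `ν`, and vanish near the other integers. -/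
def integerBump (ν t : ℝ) : ℝ := max 0 (min 1 (3 / 2 - 2 * |t - ν|))

theorem continuous_integerBump (ν : ℝ) : Continuous (integerBump ν) := by
  unfold integerBump; fun_prop

theorem integerBump_of_lt {ν t : ℝ} (h : |t - ν| < 1 / 4) : integerBump ν t = 1 := by
  rw [integerBump, min_eq_left (by linarith), max_eq_right zero_le_one]

theorem integerBump_of_ne {a b : ℕ} (hab : a ≠ b) {t : ℝ} (h : |t - b| < 1 / 4) :
    integerBump a t = 0 := by
  have h1 : (1 : ℝ) ≤ |(a : ℝ) - b| := by
    have : (1 : ℤ) ≤ |(a : ℤ) - b| := Int.one_le_abs (by omega)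
    exact_mod_cast this
  have h2 : |(a : ℝ) - b| ≤ |t - b| + |t - a| := by
    rw [abs_sub_comm t (a : ℝ), add_comm]
    exact abs_sub_le _ _ _
  rw [integerBump]
  apply max_eq_left
  exact (min_le_right _ _).trans (by linarith)

variable [CompactSpace X] [T2Space X]

/-- Orthogonal projections in a fibre that add up to one extend to sections with the same
properties near the point. -/
theorem exists_projection_sections (x : X) [FiniteDimensional ℂ (A x)] {I : Type*} [Fintype I]
    {e : I → A x} (he : ∀ i, IsStarProjection (e i)) (hee : ∀ i j, i ≠ j → e i * e j = 0)
    (hsum : ∑ i, e i = 1) :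
    ∃ P : I → Sections A, (∀ i, IsSelfAdjoint (P i)) ∧ (∀ i, evalSection A x (P i) = e i) ∧
      ∀ᶠ y in 𝓝 x, (∀ i, IsStarProjection (evalSection A y (P i))) ∧
        (∀ i j, i ≠ j → evalSection A y (P i) * evalSection A y (P j) = 0) ∧
        ∑ i, evalSection A y (P i) = 1 := by
  classical
  -- The `e i` are made the spectral projections of one self-adjoint `h` with distinct integer
  -- eigenvalues, so a single lift `s` of `h` handles all of them.
  set ν : I → ℕ := fun i => (Fintype.equivFin I i : ℕ) with hν
  have hνinj : Function.Injective ν :=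
    Fin.val_injective.comp (Fintype.equivFin I).injective
  set h := ∑ i, (ν i : ℝ) • e i with hh
  have hhs : IsSelfAdjoint h := by
    rw [IsSelfAdjoint, hh, star_sum]
    exact Finset.sum_congr rfl fun i _ => by
      rw [star_smul, star_trivial, (he i).isSelfAdjoint.star_eq]
  obtain ⟨s₀, hs₀⟩ := exists_section_apply_eq x h
  set s : Sections A := (2⁻¹ : ℝ) • (s₀ + star s₀) with hs
  have hss : IsSelfAdjoint s := by
    rw [IsSelfAdjoint, hs, star_smul, star_trivial, star_add, star_star, add_comm]
  have hsx : evalSection A x s = h := by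
    have h1 : evalSection A x s = (2⁻¹ : ℝ) • (s₀.1 x + star (s₀.1 x)) := rfl
    rw [h1, hs₀, hhs.star_eq, ← two_smul ℝ h, smul_smul]
    norm_num
  -- `q` vanishes on the eigenvalues of `h`, so `cfc q s` is small near `x`. This keeps the spectrum
  -- of `s` within 1/4 of those integers, where the bump functions behave as indicator functions.
  set q : ℝ → ℝ := fun t => Metric.infDist t (Set.range fun i => (ν i : ℝ)) with hq
  have hqc : Continuous q := Metric.continuous_infDist_pt _
  have hq0 : evalSection A x (cfc q s) = 0 := by
    rw [evalSection_cfc x hqc hss, hsx, hh, cfc_sum_smul he hee hsum]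
    refine Finset.sum_eq_zero fun i _ => ?_
    have h0 : q (ν i) = 0 := Metric.infDist_zero_of_mem ⟨i, rfl⟩
    rw [h0, zero_smul]
  have hI : Nonempty I := by
    by_contra hI
    rw [not_nonempty_iff] at hI
    simp at hsum
  refine ⟨fun i => cfc (integerBump (ν i)) s, fun i => cfc_predicate _ _, fun i => ?_, ?_⟩
  · rw [evalSection_cfc x (continuous_integerBump _) hss, hsx, hh, cfc_sum_smul he hee hsum,
      Finset.sum_eq_single i]
    · rw [integerBump_of_lt (by simp), one_smul]
    · intro j _ hj
      rw [integerBump_of_ne (fun h => hj (hνinj h).symm) (by simp), zero_smul]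
    · simp
  have hev : ∀ᶠ y in 𝓝 x, ‖evalSection A y (cfc q s)‖ < 1 / 4 :=
    eventually_norm_evalSection_lt (by rw [hq0]; norm_num)
  filter_upwards [hev] with y hy
  have hsy : IsSelfAdjoint (evalSection A y s) := hss.map (evalSection A y)
  have hspec : ∀ t ∈ spectrum ℝ (evalSection A y s), ∃ i, |t - ν i| < 1 / 4 := by
    intro t ht
    rw [evalSection_cfc y hqc hss] at hy
    have h1 : q t ∈ spectrum ℝ (cfc q (evalSection A y s)) := by
      rw [cfc_map_spectrum q _ hsy hqc.continuousOn]
      exact ⟨t, ht, rfl⟩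
    have h2 := (spectrum.norm_le_norm_of_mem h1).trans_lt hy
    have h3 : Metric.infDist t (Set.range fun i => (ν i : ℝ)) < 1 / 4 :=
      (le_abs_self _).trans_lt h2
    rw [Metric.infDist_lt_iff (Set.range_nonempty _)] at h3
    obtain ⟨_, ⟨i, rfl⟩, hi⟩ := h3
    exact ⟨i, hi⟩
  have hc : ∀ i S, ContinuousOn (integerBump (ν i)) S := fun i S =>
    (continuous_integerBump _).continuousOn
  simp only [fun i => evalSection_cfc y (continuous_integerBump (ν i : ℝ)) hss]
  refine ⟨fun i => ⟨?_, cfc_predicate _ _⟩, fun i j hij => ?_, ?_⟩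
  · rw [IsIdempotentElem, ← cfc_mul _ _ _ (hc i _) (hc i _)]
    refine cfc_congr fun t ht => ?_
    obtain ⟨l, hl⟩ := hspec t ht
    by_cases hil : i = l
    · subst hil; simp [integerBump_of_lt hl]
    · simp [integerBump_of_ne (hνinj.ne hil) hl]
  · rw [← cfc_mul _ _ _ (hc i _) (hc j _), ← cfc_zero ℝ (evalSection A y s)]
    refine cfc_congr fun t ht => ?_
    obtain ⟨l, hl⟩ := hspec t ht
    by_cases hil : i = l
    · subst hil; simp [integerBump_of_ne (hνinj.ne hij.symm) hl]
    · simp [integerBump_of_ne (hνinj.ne hil) hl]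
  · rw [← cfc_sum_univ _ _ fun i => hc i _, ← cfc_one ℝ (evalSection A y s)]
    refine cfc_congr fun t ht => ?_
    obtain ⟨l, hl⟩ := hspec t ht
    rw [Finset.sum_apply, Finset.sum_eq_single l]
    · simp [integerBump_of_lt hl]
    · intro i _ hil; exact integerBump_of_ne (hνinj.ne hil) hl
    · simp

/-- A partial isometry in a fibre between projections that extend to sections extends to a section
of partial isometries near the point. -/
theorem exists_partialIsometry_section (x : X) [FiniteDimensional ℂ (A x)] {P Q : Sections A}
    (hP : ∀ᶠ y in 𝓝 x, IsStarProjection (evalSection A y P))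
    (hQ : ∀ᶠ y in 𝓝 x, IsStarProjection (evalSection A y Q)) {v : A x}
    (hv1 : star v * v = evalSection A x P) (hv2 : v * star v = evalSection A x Q)
    (hv3 : evalSection A x Q * v = v) (hv4 : v * evalSection A x P = v) (hPs : IsSelfAdjoint P) :
    ∃ u : Sections A, evalSection A x u = v ∧ ∀ᶠ y in 𝓝 x,
      star (evalSection A y u) * evalSection A y u = evalSection A y P ∧
      evalSection A y u * star (evalSection A y u) = evalSection A y Q ∧
      evalSection A y Q * evalSection A y u = evalSection A y u ∧
      evalSection A y u * evalSection A y P = evalSection A y u := by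
  obtain ⟨w₀, hw₀⟩ := exists_section_apply_eq x v
  have hw₀ : evalSection A x w₀ = v := hw₀
  -- Compression gives the lift the required supports over nearby points without changing its value
  -- at `x`.
  set w := Q * w₀ * P with hw
  have hwx : evalSection A x w = v := by rw [hw, map_mul, map_mul, hw₀, hv3, hv4]
  set b := star w * w + 1 - P with hb
  have hbs : IsSelfAdjoint b := by
    rw [IsSelfAdjoint, hb]
    simp [hPs.star_eq]
  have hbev : ∀ y, evalSection A y b = star (evalSection A y w) * evalSection A y w + 1 -
      evalSection A y P := fun y => by
    rw [hb, map_sub, map_add, map_mul, map_star, map_one]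
  have hbx : evalSection A x b = 1 := by
    rw [hbev, hwx, hv1, add_sub_cancel_left]
  set u := w * cfc invSqrtCutoff b with hu
  have huev : ∀ y, evalSection A y u = evalSection A y w *
      cfc invSqrtCutoff (star (evalSection A y w) * evalSection A y w + 1 - evalSection A y P) :=
    fun y => by rw [hu, map_mul, evalSection_cfc y continuous_invSqrtCutoff hbs, hbev]
  have hux : evalSection A x u = v := by
    rw [huev, ← hbev, hbx, cfc_apply_one, invSqrtCutoff_one, map_one, mul_one, hwx]
  refine ⟨u, hux, ?_⟩
  have h1 : ∀ᶠ y in 𝓝 x, ‖evalSection A y (b - 1)‖ < 1 / 2 :=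
    eventually_norm_evalSection_lt (by rw [map_sub, hbx, map_one, sub_self]; norm_num)
  have h2 : ∀ᶠ y in 𝓝 x, ‖evalSection A y (Q - u * star u)‖ < 1 :=
    eventually_norm_evalSection_lt (by
      rw [map_sub, map_mul, map_star, hux, hv2, sub_self]; norm_num)
  filter_upwards [h1, h2, hP, hQ] with y h1 h2 hPy hQy
  rw [map_sub, hbev, map_one] at h1
  rw [map_sub, map_mul, map_star] at h2
  refine polar_partialIsometry hPy hQy ?_ ?_ h1 (huev y) h2
  · rw [hw, map_mul, mul_assoc, hPy.isIdempotentElem.eq]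
  · rw [hw, map_mul, map_mul, ← mul_assoc, ← mul_assoc, hQy.isIdempotentElem.eq]

/-- Every finite-dimensional fibre has a local extension. -/
theorem nonempty_localExtension (x : X) [FiniteDimensional ℂ (A x)] :
    Nonempty (LocalExtension A x) := by
  obtain ⟨k, n, ⟨χ⟩⟩ := exists_starAlgEquiv_multiMatrix (A x)
  let ε : ∀ i, Fin (n i) → Fin (n i) → A x := fun i a b => χ.symm (matrixUnit n i a b)
  have hε_mul : ∀ i a b c, ε i a b * ε i b c = ε i a c := fun i a b c => by
    rw [← map_mul, matrixUnit_mul_matrixUnit]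
  have hε_star : ∀ i a b, star (ε i a b) = ε i b a := fun i a b => by
    rw [← map_star, star_matrixUnit]
  obtain ⟨P, hPs, hPx, hP⟩ := exists_projection_sections x
    (I := Σ i, Fin (n i)) (e := fun i => ε i.1 i.2 i.2)
    (fun i => (isStarProjection_matrixUnit i.1 i.2).map χ.symm)
    (by
      rintro ⟨i, a⟩ ⟨j, b⟩ h
      change χ.symm _ * χ.symm _ = 0
      rw [← map_mul]
      by_cases hij : i = j
      · subst hij
        rw [matrixUnit_mul_matrixUnit_of_ne _ _ _ fun hab => h (Sigma.ext rfl (heq_of_eq hab)),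
          map_zero]
      · rw [matrixUnit_mul_matrixUnit_of_ne_factor hij, map_zero])
    (by
      rw [Fintype.sum_sigma]
      change ∑ i, ∑ a, χ.symm _ = 1
      simp only [← map_sum]
      rw [sum_matrixUnit_self, map_one])
  let o : ∀ i, Fin (n i) := fun i => ⟨0, (n i).pos⟩
  -- Only one column of each matrix block is lifted; the other matrix units are the products `u i a
  -- * star (u i b)`.
  have hu : ∀ i a, ∃ u : Sections A, evalSection A x u = ε i a (o i) ∧ ∀ᶠ y in 𝓝 x,
      star (evalSection A y u) * evalSection A y u = evalSection A y (P ⟨i, o i⟩) ∧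
      evalSection A y u * star (evalSection A y u) = evalSection A y (P ⟨i, a⟩) ∧
      evalSection A y (P ⟨i, a⟩) * evalSection A y u = evalSection A y u ∧
      evalSection A y u * evalSection A y (P ⟨i, o i⟩) = evalSection A y u := fun i a =>
    exists_partialIsometry_section x (hP.mono fun y h => h.1 _) (hP.mono fun y h => h.1 _)
      (by rw [hPx, hε_star, hε_mul]) (by rw [hPx, hε_star, hε_mul]) (by rw [hPx, hε_mul])
      (by rw [hPx, hε_mul]) (hPs _)
  choose u hux hu using hu
  have hnz : ∀ i a, ∀ᶠ y in 𝓝 x, evalSection A y (P ⟨i, a⟩) ≠ 0 := fun i a => by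
    have h1 : 0 < ‖evalSection A x (P ⟨i, a⟩)‖ := by
      rw [hPx, norm_pos_iff]
      exact fun h => matrixUnit_ne_zero i a a (by
        rw [← χ.apply_symm_apply (matrixUnit n i a a)]
        exact (congrArg χ h).trans (map_zero χ))
    filter_upwards [(continuous_norm_evalSection (P ⟨i, a⟩)).continuousAt.eventually
      (lt_mem_nhds h1)] with y hy
    exact norm_pos_iff.1 hy
  have hall : ∀ᶠ y in 𝓝 x, (∀ i a, evalSection A y (u i a) * star (evalSection A y (u i a)) ≠ 0) ∧
      IsMatrixUnitSystem fun i a b => evalSection A y (u i a) * star (evalSection A y (u i b)) := by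
    have h1 := eventually_all.2 fun i => eventually_all.2 fun a => hnz i a
    have h2 := eventually_all.2 fun i => eventually_all.2 fun a => hu i a
    filter_upwards [h1, h2, hP] with y h1 h2 ⟨hPp, hPP, hPsum⟩
    have horth : ∀ i j a b, (⟨i, a⟩ : Σ i, Fin (n i)) ≠ ⟨j, b⟩ →
        star (evalSection A y (u i a)) * evalSection A y (u j b) = 0 := by
      intro i j a b h
      rw [← (h2 i a).2.2.1, ← (h2 j b).2.2.1, star_mul, (hPp _).isSelfAdjoint.star_eq, mul_assoc,
        ← mul_assoc (evalSection A y (P _)), hPP _ _ h, zero_mul, mul_zero]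
    refine ⟨fun i a => (h2 i a).2.1 ▸ h1 i a, isMatrixUnitSystem_of_partialIsometries
      (p := fun i => evalSection A y (P ⟨i, o i⟩)) (fun i a => (h2 i a).1)
      (fun i a => (h2 i a).2.2.2)
      (fun i a b hab => horth i i a b fun h => hab (by simpa using h))
      (fun i j a b hij => horth i j a b fun h => hij (congrArg Sigma.fst h)) ?_⟩
    rw [← hPsum, Fintype.sum_sigma]
    exact Finset.sum_congr rfl fun i _ => Finset.sum_congr rfl fun a _ => (h2 i a).2.1
  refine ⟨⟨_, hall, fun y => y.2.2.hom.comp (χ : A x →⋆ₐ[ℂ] MultiMatrix n), fun y => ?_,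
    fun a => ?_, fun a => ?_⟩⟩
  · exact (y.2.2.hom_injective y.2.1).comp (EquivLike.injective χ)
  · change hall.self_of_nhds.2.hom (χ a) = a
    rw [IsMatrixUnitSystem.hom_apply]
    simp only [hux, hε_star, hε_mul]
    conv_rhs => rw [← χ.symm_apply_apply a, MultiMatrix.eq_sum_matrixUnit (χ a)]
    simp only [map_sum, map_smul]
    rfl
  · have h1 : Continuous fun y => (⟨y, evalSection A y
        (∑ i, ∑ c, ∑ d, χ a i c d • (u i c * star (u i d)))⟩ : Tot A) :=
      (∑ i, ∑ c, ∑ d, χ a i c d • (u i c * star (u i d)) : Sections A).2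
    refine (h1.comp continuous_subtype_val).congr fun y => ?_
    simp only [Function.comp_apply, map_sum, map_smul, map_mul, map_star]
    rfl

end LocalExtension
end

noncomputable section

/-! ### The canonical trace of a finite-dimensional C*-algebra -/

section FibreTrace

open scoped ComplexOrder

variable (B : Type*) [CStarAlgebra B] [FiniteDimensional ℂ B]

/-- The number of summands of a finite-dimensional C*-algebra. -/
def numFactors : ℕ := (exists_starAlgEquiv_multiMatrix B).choose

/-- The sizes of the matrix summands of a finite-dimensional C*-algebra. -/
def factorSize : Fin (numFactors B) → ℕ+ := (exists_starAlgEquiv_multiMatrix B).choose_spec.choose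

/-- An identification of a finite-dimensional C*-algebra with a multi-matrix algebra. -/
def multiMatrixEquiv : B ≃⋆ₐ[ℂ] MultiMatrix (factorSize B) :=
  (exists_starAlgEquiv_multiMatrix B).choose_spec.choose_spec.some

/-- The rank of a finite-dimensional C*-algebra, as a natural number. -/
def fdRank : ℕ := ∑ i, (factorSize B i : ℕ)

theorem cstarRank_eq_fdRank : cstarRank B = fdRank B := cstarRank_eq (multiMatrixEquiv B)

theorem fdRank_eq {k : ℕ} {n : Fin k → ℕ+} (χ : B ≃⋆ₐ[ℂ] MultiMatrix n) :
    fdRank B = ∑ i, (n i : ℕ) := by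
  have := (cstarRank_eq_fdRank B).symm.trans (cstarRank_eq χ)
  exact_mod_cast this

theorem fdRank_le_finrank : fdRank B ≤ Module.finrank ℂ B := by
  refine le_trans ?_ (LinearMap.finrank_le_finrank_of_injective
    (f := ((multiMatrixEquiv B).symm : MultiMatrix (factorSize B) →⋆ₐ[ℂ] B).toAlgHom.toLinearMap)
    (EquivLike.injective (multiMatrixEquiv B).symm))
  rw [Module.finrank_pi_fintype]
  refine Finset.sum_le_sum fun i _ => ?_
  rw [Module.finrank_matrix]
  simpa using Nat.le_mul_self (factorSize B i)

/-- The sum of the un-normalized traces of the matrix summands. -/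
def fdTrace : B →ₗ[ℂ] ℂ :=
  traceSum (factorSize B) ∘ₗ
    (multiMatrixEquiv B : B →⋆ₐ[ℂ] MultiMatrix (factorSize B)).toAlgHom.toLinearMap

theorem fdTrace_apply (b : B) : fdTrace B b = traceSum (factorSize B) (multiMatrixEquiv B b) := rfl

theorem fdTrace_one : fdTrace B 1 = fdRank B := by
  rw [fdTrace_apply, map_one, traceSum_one, fdRank]

variable {B}

theorem fdTrace_mul_comm (a b : B) : fdTrace B (a * b) = fdTrace B (b * a) := by
  rw [fdTrace_apply, fdTrace_apply, map_mul (multiMatrixEquiv B), map_mul (multiMatrixEquiv B),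
    traceSum_mul_comm]

theorem norm_fdTrace_le (b : B) : ‖fdTrace B b‖ ≤ fdRank B * ‖b‖ :=
  norm_traceSum_le (multiMatrixEquiv B) b

theorem norm_le_fdTrace (b : B) : (‖star b * b‖ : ℂ) ≤ fdTrace B (star b * b) :=
  norm_le_traceSum (multiMatrixEquiv B) b

theorem exists_fdTrace_eq_natCast {p : B} (hp : IsIdempotentElem p) :
    ∃ r : ℕ, fdTrace B p = r ∧ (p ≠ 0 → 1 ≤ r) := by
  obtain ⟨r, hr, hr'⟩ := exists_traceSum_eq_natCast (hp.map (multiMatrixEquiv B))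
  exact ⟨r, hr, fun h => hr' ((map_ne_zero_iff _ (EquivLike.injective (multiMatrixEquiv B))).2 h)⟩

theorem one_le_fdTrace {p : B} (hp : IsIdempotentElem p) (h : p ≠ 0) : 1 ≤ fdTrace B p := by
  obtain ⟨r, hr, hr'⟩ := exists_fdTrace_eq_natCast hp
  rw [hr]
  exact_mod_cast hr' h

/-- The traces of `p` and `1 - p` are natural numbers adding up to the rank. -/
theorem exists_fdTrace_eq_natCast_le {p : B} (hp : IsIdempotentElem p) :
    ∃ r : ℕ, r ≤ fdRank B ∧ fdTrace B p = r := by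
  obtain ⟨r, hr, -⟩ := exists_fdTrace_eq_natCast hp
  obtain ⟨q, hq, -⟩ := exists_fdTrace_eq_natCast hp.one_sub
  rw [map_sub, fdTrace_one, hr, sub_eq_iff_eq_add] at hq
  have : fdRank B = q + r := by exact_mod_cast hq
  exact ⟨r, by omega, hr⟩

/-- The characterization of the canonical trace by its values at projections. -/
theorem eq_fdTrace {f : B →ₗ[ℂ] ℂ} (h1 : f 1 = fdRank B)
    (hf : ∀ p, IsStarProjection p → p ≠ 0 → 1 ≤ f p) (b : B) : f b = fdTrace B b := by
  set χ := multiMatrixEquiv B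
  have h := eq_traceSum
    (f := f ∘ₗ (χ.symm : MultiMatrix (factorSize B) →⋆ₐ[ℂ] B).toAlgHom.toLinearMap)
    (by change f (χ.symm 1) = _; rw [map_one, h1, fdRank])
    (fun p hp h0 => hf _ (hp.map χ.symm)
      ((map_ne_zero_iff _ (EquivLike.injective χ.symm)).2 h0))
  have h2 := LinearMap.congr_fun h (χ b)
  rw [fdTrace_apply, ← h2]
  change _ = f (χ.symm (χ b))
  rw [χ.symm_apply_apply]

/-- Both functionals meet the criterion `eq_fdTrace`, which refers only to projections and the rank;
so the trace does not depend on the chosen identification. -/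
theorem fdTrace_eq_traceSum {k : ℕ} {n : Fin k → ℕ+} (χ : B ≃⋆ₐ[ℂ] MultiMatrix n) (b : B) :
    fdTrace B b = traceSum n (χ b) := by
  refine (eq_fdTrace (f := traceSum n ∘ₗ (χ : B →⋆ₐ[ℂ] MultiMatrix n).toAlgHom.toLinearMap)
    ?_ (fun p hp h0 => ?_) b).symm
  · change traceSum n (χ 1) = _
    rw [map_one, traceSum_one, fdRank_eq B χ]
  · exact one_le_traceSum (hp.isIdempotentElem.map χ)
      ((map_ne_zero_iff _ (EquivLike.injective χ)).2 h0)

/-- Summing a column of the Bratteli matrix over its rows gives the trace sum of the image of the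
minimal projection, so the tuple is unique. -/
theorem isColumnSumTuple_iff {k : ℕ} {m : Fin k → ℕ+} (ι : MultiMatrix m →⋆ₐ[ℂ] B)
    (c : Fin k → ℂ) :
    IsColumnSumTuple ι c ↔ (fun j => fdTrace B (ι (minimalProjection m j))) = c := by
  have key : ∀ (l : ℕ) (n : Fin l → ℕ+) (χ : B ≃⋆ₐ[ℂ] MultiMatrix n) (j : Fin k),
      ∑ i, bratteliMatrix ((χ : B →⋆ₐ[ℂ] MultiMatrix n).comp ι) i j =
        fdTrace B (ι (minimalProjection m j)) := fun l n χ j => by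
    rw [fdTrace_eq_traceSum χ, traceSum_apply]
    rfl
  constructor
  · rintro ⟨l, n, χ, h⟩
    funext j
    rw [← h j, key]
  · rintro rfl
    exact ⟨_, _, multiMatrixEquiv B, fun j => key _ _ _ j⟩

theorem isStarProjection_minimalProjection {k : ℕ} (m : Fin k → ℕ+) (j : Fin k) :
    IsStarProjection (minimalProjection m j) := isStarProjection_matrixUnit _ _

/-- The pull-back of the canonical trace is determined by the column sums. -/
theorem fdTrace_comp_apply {k : ℕ} {m : Fin k → ℕ+} (ι : MultiMatrix m →⋆ₐ[ℂ] B)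
    (x : MultiMatrix m) :
    fdTrace B (ι x) = ∑ j, fdTrace B (ι (minimalProjection m j)) * (x j).trace :=
  tracial_apply (f := fdTrace B ∘ₗ ι.toAlgHom.toLinearMap)
    (fun a b => by
      change fdTrace B (ι (a * b)) = fdTrace B (ι (b * a))
      rw [map_mul ι, map_mul ι, fdTrace_mul_comm]) x

/-- The rank is monotone under unital embeddings. -/
theorem fdRank_le_of_injective {C : Type*} [CStarAlgebra C] [FiniteDimensional ℂ C]
    (φ : B →⋆ₐ[ℂ] C) (hφ : Function.Injective φ) : fdRank B ≤ fdRank C := by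
  set χ := multiMatrixEquiv B
  -- In `C` the unit is a sum of `fdRank B` nonzero projections, each of trace at least one.
  have h1 : (fdRank C : ℂ) = ∑ i, ∑ a, fdTrace C (φ (χ.symm (matrixUnit (factorSize B) i a a))) := by
    simp only [← map_sum]
    rw [sum_matrixUnit_self, map_one, map_one, fdTrace_one]
  have h2 : ∑ i, ∑ _a : Fin (factorSize B i), (1 : ℂ) ≤ fdRank C := by
    rw [h1]
    refine Finset.sum_le_sum fun i _ => Finset.sum_le_sum fun a _ => one_le_fdTrace ?_ ?_
    · exact ((isStarProjection_matrixUnit i a).isIdempotentElem.map χ.symm).map φ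
    · rw [map_ne_zero_iff φ hφ, map_ne_zero_iff _ (EquivLike.injective χ.symm)]
      exact matrixUnit_ne_zero i a a
  have h3 : ((fdRank B : ℕ) : ℂ) ≤ fdRank C := by
    refine le_trans (le_of_eq ?_) h2
    simp [fdRank]
  exact_mod_cast h3

end FibreTrace
end

noncomputable section

/-! ### Optimal expectations and germs of column-sum tuples -/

section MaxRank

variable {X : Type*} {A : X → Type*} [∀ x, CStarAlgebra (A x)] [∀ x, FiniteDimensional ℂ (A x)]

theorem exists_bundleRank_eq (hsub : IsSubhomogeneous A) : ∃ R : ℕ, bundleRank A = R := by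
  obtain ⟨N, hN⟩ := hsub
  have h : bundleRank A ≤ N := iSup_le fun x => by
    rw [cstarRank_eq_fdRank]
    exact_mod_cast (fdRank_le_finrank (A x)).trans (hN x).2
  exact ENat.ne_top_iff_exists.1 (ne_top_of_le_ne_top (ENat.natCast_ne_top N) h) |>.imp
    fun _ h => h.symm

variable {R : ℕ} (hR : bundleRank A = R)

include hR

theorem fdRank_le (x : X) : fdRank (A x) ≤ R := by
  have h : cstarRank (A x) ≤ bundleRank A := le_iSup (fun x => cstarRank (A x)) x
  rw [cstarRank_eq_fdRank, hR] at h
  exact_mod_cast h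

theorem mem_maxRankLocus_iff (x : X) : x ∈ maxRankLocus A ↔ fdRank (A x) = R := by
  rw [maxRankLocus, Set.mem_ofPred_eq, cstarRank_eq_fdRank, hR]
  exact Nat.cast_inj

/-- A local extension embeds the fibre at `x` unitally into all nearby fibres, so their ranks are at
least the maximal one. -/
theorem isOpen_maxRankLocus [TopologicalSpace X] [CompactSpace X] [T2Space X] [∀ x, Nontrivial (A x)]
    [TopologicalSpace (Tot A)] [IsUnitalFCStarBundle A] : IsOpen (maxRankLocus A) := by
  refine isOpen_iff_mem_nhds.2 fun x hx => ?_
  obtain ⟨L⟩ := nonempty_localExtension (A := A) x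
  filter_upwards [L.mem_nhds] with y hy
  rw [mem_maxRankLocus_iff hR] at hx ⊢
  exact le_antisymm (fdRank_le hR y) (hx ▸ fdRank_le_of_injective _ (L.injective ⟨y, hy⟩))

end MaxRank

/-! ### Finiteness and existence of germs of column-sum tuples -/

section Germs

variable {X : Type*} [TopologicalSpace X] {A : X → Type*} [∀ x, CStarAlgebra (A x)]
  [∀ x, FiniteDimensional ℂ (A x)] [TopologicalSpace (Tot A)] {R : ℕ} (hR : bundleRank A = R)

open Classical in
/-- The column-sum tuple of a local extension at a point, with value zero off its domain. -/
def LocalExtension.colTuple {x : X} (L : LocalExtension A x) {k : ℕ} {m : Fin k → ℕ+}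
    (ψ : MultiMatrix m ≃⋆ₐ[ℂ] A x) (y : X) (j : Fin k) : ℂ :=
  if h : y ∈ L.U then fdTrace (A y) (L.hom ⟨y, h⟩ (ψ (minimalProjection m j))) else 0

theorem LocalExtension.colTuple_apply {x : X} (L : LocalExtension A x) {k : ℕ} {m : Fin k → ℕ+}
    (ψ : MultiMatrix m ≃⋆ₐ[ℂ] A x) {y : X} (h : y ∈ L.U) (j : Fin k) :
    L.colTuple ψ y j = fdTrace (A y) (L.hom ⟨y, h⟩ (ψ (minimalProjection m j))) := dif_pos h

theorem isColumnSumGerm_iff {x : X} {k : ℕ} {m : Fin k → ℕ+} (ψ : MultiMatrix m ≃⋆ₐ[ℂ] A x)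
    (c : Fin k → ℂ) : IsColumnSumGerm ψ c ↔
      ∃ L : LocalExtension A x, ∃ᶠ y in 𝓝[maxRankLocus A] x, L.colTuple ψ y = c := by
  refine exists_congr fun L => ?_
  rw [frequently_nhdsWithin_iff, frequently_iff]
  simp only [isColumnSumTuple_iff]
  constructor
  · intro h V hV
    obtain ⟨y, hyV, hy, hc⟩ := h V hV
    exact ⟨y, hyV, by rw [← hc]; funext j; exact L.colTuple_apply ψ y.2 j, hy⟩
  · intro h V hV
    obtain ⟨y, ⟨hyV, hyU⟩, hc, hy⟩ := h (U := V ∩ L.U) (inter_mem hV L.mem_nhds)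
    exact ⟨⟨y, hyU⟩, hyV, hy, by rw [← hc]; funext j; exact (L.colTuple_apply ψ hyU j).symm⟩

/-- The pulled-back trace thus depends on `y` only through the column-sum tuple. -/
theorem LocalExtension.fdTrace_hom {x : X} (L : LocalExtension A x) {k : ℕ} {m : Fin k → ℕ+}
    (ψ : MultiMatrix m ≃⋆ₐ[ℂ] A x) {y : X} (h : y ∈ L.U) (a : A x) :
    fdTrace (A y) (L.hom ⟨y, h⟩ a) = ∑ j, L.colTuple ψ y j * (ψ.symm a j).trace := by
  have h1 := fdTrace_comp_apply ((L.hom ⟨y, h⟩).comp (ψ : MultiMatrix m →⋆ₐ[ℂ] A x)) (ψ.symm a)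
  have h2 : ((L.hom ⟨y, h⟩).comp (ψ : MultiMatrix m →⋆ₐ[ℂ] A x)) (ψ.symm a) =
      L.hom ⟨y, h⟩ a := congrArg _ (ψ.apply_symm_apply a)
  rw [h2] at h1
  rw [h1]
  exact Finset.sum_congr rfl fun j _ => by rw [L.colTuple_apply ψ h]; rfl

/-- A finite set of tuples that contains all column-sum tuples. -/
def natTuples (k R : ℕ) : Set (Fin k → ℂ) := {c | ∀ j, c j ∈ (fun r : ℕ => (r : ℂ)) '' Set.Iic R}

theorem finite_natTuples (k R : ℕ) : (natTuples k R).Finite :=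
  Set.Finite.pi' fun _ => (Set.finite_Iic R).image _

include hR in
theorem LocalExtension.colTuple_mem {x : X} (L : LocalExtension A x) {k : ℕ} {m : Fin k → ℕ+}
    (ψ : MultiMatrix m ≃⋆ₐ[ℂ] A x) (y : X) : L.colTuple ψ y ∈ natTuples k R := by
  intro j
  by_cases h : y ∈ L.U
  · rw [L.colTuple_apply ψ h]
    obtain ⟨r, hr, hr'⟩ := exists_fdTrace_eq_natCast_le
      (((isStarProjection_minimalProjection m j).isIdempotentElem.map ψ).map (L.hom ⟨y, h⟩))
    exact ⟨r, hr.trans (fdRank_le hR y), hr'.symm⟩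
  · exact ⟨0, Nat.zero_le _, by simp [LocalExtension.colTuple, h]⟩

/-- The pigeonhole principle along a filter. -/
theorem exists_frequently_eq_of_finite {α β : Type*} {l : Filter α} {F : Set β} (hF : F.Finite)
    {f : α → β} (hf : ∀ a, f a ∈ F) {P : α → Prop} (hP : ∃ᶠ a in l, P a) :
    ∃ b, ∃ᶠ a in l, P a ∧ f a = b := by
  by_contra! hcon
  have h := (eventually_all_finite hF).2 fun b _ => hcon b
  obtain ⟨a, ha, ha'⟩ := (hP.and_eventually h).exists
  exact ha' _ (hf a) ha rfl

include hR in
-- By density, points of maximal rank accumulate at `x`, and one of the finitely many tuples must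
-- recur along them.
theorem exists_isColumnSumGerm [CompactSpace X] [T2Space X] [∀ x, Nontrivial (A x)]
    [IsUnitalFCStarBundle A] (hd : Dense (maxRankLocus A)) {x : X} {k : ℕ} {m : Fin k → ℕ+}
    (ψ : MultiMatrix m ≃⋆ₐ[ℂ] A x) : ∃ c, IsColumnSumGerm ψ c := by
  obtain ⟨L⟩ := nonempty_localExtension (A := A) x
  have := mem_closure_iff_nhdsWithin_neBot.1 (hd x)
  obtain ⟨c, hc⟩ := exists_frequently_eq_of_finite (l := 𝓝[maxRankLocus A] x)
    (finite_natTuples k R) (L.colTuple_mem hR ψ) (Frequently.of_forall fun _ => trivial)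
  exact ⟨c, (isColumnSumGerm_iff ψ c).2 ⟨L, hc.mono fun _ h => h.2⟩⟩

include hR in
/-- If the germ of column-sum tuples is unique, then the canonical traces near the point, pulled
back along a local extension, are eventually constant. -/
theorem exists_limit_functional {x : X}
    (h : ∀ (k : ℕ) (m : Fin k → ℕ+) (ψ : MultiMatrix m ≃⋆ₐ[ℂ] A x), ∃! c, IsColumnSumGerm ψ c) :
    ∃ (τ : A x →ₗ[ℂ] ℂ) (L : LocalExtension A x), ∀ᶠ y in 𝓝[maxRankLocus A] x,
      ∃ hy : y ∈ L.U, ∀ a, fdTrace (A y) (L.hom ⟨y, hy⟩ a) = τ a := by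
  set ψ := (multiMatrixEquiv (A x)).symm
  obtain ⟨c, hc, hc'⟩ := h _ _ ψ
  obtain ⟨L, hL⟩ := (isColumnSumGerm_iff ψ c).1 hc
  -- If values other than `c` recurred, one fixed such value would recur and be a second germ,
  -- attained by the same extension `L`.
  have hev : ∀ᶠ y in 𝓝[maxRankLocus A] x, L.colTuple ψ y = c := by
    by_contra hcon
    rw [not_eventually] at hcon
    obtain ⟨b, hb⟩ := exists_frequently_eq_of_finite (finite_natTuples _ R)
      (L.colTuple_mem hR ψ) hcon
    obtain ⟨y, hy, hyb⟩ := hb.exists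
    exact hy (hyb.trans (hc' b ((isColumnSumGerm_iff ψ b).2 ⟨L, hb.mono fun _ h => h.2⟩)))
  refine ⟨∑ j, c j • (Matrix.traceLinearMap (Fin (factorSize (A x) j)) ℂ ℂ ∘ₗ LinearMap.proj j) ∘ₗ
    (ψ.symm : A x →⋆ₐ[ℂ] MultiMatrix _).toAlgHom.toLinearMap, L, ?_⟩
  filter_upwards [hev, mem_nhdsWithin_of_mem_nhds L.mem_nhds] with y hy hyU
  refine ⟨hyU, fun a => ?_⟩
  rw [L.fdTrace_hom ψ hyU, hy, LinearMap.sum_apply]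
  rfl

end Germs

/-! ### Approximation by local extensions and positivity of sections -/

section Positivity

variable {X : Type*} [TopologicalSpace X] {A : X → Type*} [∀ x, CStarAlgebra (A x)]
  [∀ x, Nontrivial (A x)] [TopologicalSpace (Tot A)] [hA : IsUnitalFCStarBundle A]

/-- The two sides agree at `x`, and the norm of their difference is continuous on `L.U`. -/
theorem LocalExtension.eventually_norm_sub_lt {x : X} (L : LocalExtension A x) (s : Sections A)
    {ε : ℝ} (hε : 0 < ε) :
    ∀ᶠ y in 𝓝 x, ∃ hy : y ∈ L.U, ‖s.1 y - L.hom ⟨y, hy⟩ (s.1 x)‖ < ε := by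
  have h1 : Continuous fun y : L.U =>
      (⟨y, (s.1 y, L.hom y (s.1 x))⟩ : FibreSquare A) :=
    continuous_induced_rng.2 ((s.2.comp continuous_subtype_val).prodMk (L.continuous (s.1 x)))
  have h2 : Continuous fun y : L.U => ‖s.1 y - L.hom y (s.1 x)‖ :=
    continuous_norm_sub_fibre.comp h1
  have h3 : ∀ᶠ y : L.U in 𝓝 (⟨x, mem_of_mem_nhds L.mem_nhds⟩ : L.U),
      ‖s.1 y - L.hom y (s.1 x)‖ < ε := by
    refine h2.continuousAt.eventually_lt continuousAt_const ?_
    rw [L.hom_self, sub_self, norm_zero]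
    exact hε
  rw [nhds_subtype, eventually_comap] at h3
  filter_upwards [h3, L.mem_nhds] with y hy hyU
  exact ⟨hyU, hy ⟨y, hyU⟩ rfl⟩

theorem Sections.ext {s t : Sections A} (h : ∀ x, s.1 x = t.1 x) : s = t :=
  Subtype.ext (lp.ext (funext h))

theorem exists_star_mul_self_apply {a : Sections A} (ha : 0 ≤ a) :
    ∃ b : Sections A, ∀ x, a.1 x = star (b.1 x) * b.1 x := by
  obtain ⟨b, rfl⟩ := CStarAlgebra.nonneg_iff_eq_star_mul_self.1 ha
  exact ⟨b, fun x => rfl⟩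

variable [CompactSpace X]

variable (A) in
/-- The section of real multiples of the unit. -/
def realSection (f : C(X, ℝ)) : Sections A :=
  scalarSection A ⟨fun x => (f x : ℂ), Complex.continuous_ofReal.comp f.continuous⟩

theorem scalarSection_apply (f : C(X, ℂ)) (x : X) : (scalarSection A f).1 x = f x • 1 := rfl

/-- A self-adjoint section is bounded above by every scalar function that bounds its norm. -/
theorem nonneg_realSection_sub {s : Sections A} (hs : IsSelfAdjoint s) {f : C(X, ℝ)}
    (h : ∀ x, ‖s.1 x‖ ≤ f x) : 0 ≤ realSection A f - s := by
  -- A norm estimate replaces fibrewise positivity: `‖v‖ ≤ ‖f‖` gives `v ≤ ‖f‖`, which rearranges to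
  -- the claim.
  set v : Sections A := algebraMap ℝ (Sections A) ‖f‖ - (realSection A f - s) with hv
  have hfs : IsSelfAdjoint (realSection A f) := by
    refine Sections.ext fun x => ?_
    change star ((f x : ℂ) • (1 : A x)) = (f x : ℂ) • 1
    simp
  have hvs : IsSelfAdjoint v := ((IsSelfAdjoint.all _).algebraMap _).sub (hfs.sub hs)
  have hvx : ∀ x, v.1 x = ((‖f‖ - f x : ℝ) : ℂ) • (1 : A x) + s.1 x := by
    intro x
    change algebraMap ℝ (A x) ‖f‖ - ((f x : ℂ) • (1 : A x) - s.1 x) = _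
    rw [Algebra.algebraMap_eq_smul_one, Complex.ofReal_sub, sub_smul, Complex.coe_smul,
      Complex.coe_smul]
    abel
  have hvn : ‖v‖ ≤ ‖f‖ := by
    refine lp.norm_le_of_forall_le (norm_nonneg f) fun x => ?_
    have h1 : 0 ≤ ‖f‖ - f x := sub_nonneg.2 ((le_abs_self _).trans (f.norm_coe_le_norm x))
    calc ‖v.1 x‖ ≤ (‖f‖ - f x) + f x := by
          rw [hvx]
          refine (norm_add_le _ _).trans (add_le_add ?_ (h x))
          rw [norm_smul, norm_one, mul_one, Complex.norm_real, Real.norm_of_nonneg h1]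
      _ = ‖f‖ := by ring
  have h1 : v ≤ algebraMap ℝ (Sections A) ‖f‖ :=
    hvs.le_algebraMap_norm_self.trans (algebraMap_mono _ hvn)
  rw [hv] at h1
  simpa using h1

end Positivity

end

noncomputable section

section Expectations

open scoped ComplexOrder

/-- Compressing by `p` turns the left side into `(z - 1) • p`, which is still of the form `star a *
a`. -/
theorem one_le_of_smul_one_sub_eq {B : Type*} [CStarAlgebra B] {p d : B} (hp : IsStarProjection p)
    (hp0 : p ≠ 0) {z : ℂ} (h : z • 1 - p = star d * d) : 1 ≤ z := by
  have hpp := hp.isIdempotentElem.eq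
  have h1 : star (d * p) * (d * p) = (z - 1) • p := by
    calc star (d * p) * (d * p) = p * (star d * d) * p := by
          rw [star_mul, hp.isSelfAdjoint.star_eq]; simp only [mul_assoc]
      _ = (z - 1) • p := by
          rw [← h, mul_sub, sub_mul, hpp, hpp, mul_smul_comm, mul_one, smul_mul_assoc, hpp,
            sub_smul, one_smul]
  obtain ⟨r, hr, hzr⟩ := nonneg_of_star_mul_self_eq_smul hp hp0 h1
  rw [← sub_nonneg, hzr]
  exact_mod_cast hr

theorem fdRank_pos (B : Type*) [CStarAlgebra B] [FiniteDimensional ℂ B] [Nontrivial B] :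
    0 < fdRank B := by
  have h := one_le_fdTrace (p := (1 : B)) IsIdempotentElem.one one_ne_zero
  rw [fdTrace_one] at h
  exact_mod_cast h

theorem exists_projection_fdTrace_eq_one (B : Type*) [CStarAlgebra B] [FiniteDimensional ℂ B]
    [Nontrivial B] : ∃ p : B, IsStarProjection p ∧ p ≠ 0 ∧ fdTrace B p = 1 := by
  have h := fdRank_pos B
  rw [fdRank] at h
  obtain ⟨i, -, -⟩ := Finset.exists_ne_zero_of_sum_ne_zero h.ne'
  let o : Fin (factorSize B i) := ⟨0, (factorSize B i).pos⟩
  refine ⟨(multiMatrixEquiv B).symm (matrixUnit _ i o o), (isStarProjection_matrixUnit i o).map _,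
    (map_ne_zero_iff _ (EquivLike.injective _)).2 (matrixUnit_ne_zero i o o), ?_⟩
  rw [fdTrace_apply, StarAlgEquiv.apply_symm_apply, traceSum_matrixUnit, if_pos rfl]

variable {X : Type*} [TopologicalSpace X] {A : X → Type*} [∀ x, CStarAlgebra (A x)]
  [∀ x, FiniteDimensional ℂ (A x)] [TopologicalSpace (Tot A)] {R : ℕ} (hR : bundleRank A = R)

/-! ### From limits of traces to an optimal expectation -/

section OfLimits

variable {τ : ∀ x, A x →ₗ[ℂ] ℂ} {L : ∀ x, LocalExtension A x}
  (hτ : ∀ x, ∀ᶠ y in 𝓝[maxRankLocus A] x,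
      ∃ hy : y ∈ (L x).U, ∀ a, fdTrace (A y) ((L x).hom ⟨y, hy⟩ a) = τ x a)

include hτ

/-- An eventual property within the locus holds at `y` itself, where the extension is the identity.
-/
theorem fdTrace_eq_of_mem {y : X} (hy : y ∈ maxRankLocus A) (a : A y) :
    fdTrace (A y) a = τ y a := by
  obtain ⟨h1, h2⟩ := (hτ y).self_of_nhdsWithin hy
  rw [← h2 a, (L y).hom_self]

/-- A single isometric embedding into a fibre of maximal rank transfers the value at 1, the norm
bound and the lower bound on positive elements from the canonical trace to `τ x`. -/
theorem exists_hom_fdTrace_eq (hd : Dense (maxRankLocus A)) (x : X) :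
    ∃ y ∈ maxRankLocus A, ∃ φ : A x →⋆ₐ[ℂ] A y, (∀ a, ‖φ a‖ = ‖a‖) ∧
      ∀ a, fdTrace (A y) (φ a) = τ x a := by
  have := mem_closure_iff_nhdsWithin_neBot.1 (hd x)
  obtain ⟨y, ⟨hyU, h⟩, hy⟩ := ((hτ x).and self_mem_nhdsWithin).exists
  exact ⟨y, hy, (L x).hom ⟨y, hyU⟩,
    NonUnitalStarAlgHom.norm_map _ ((L x).injective ⟨y, hyU⟩), h⟩

variable [∀ x, Nontrivial (A x)] [hA : IsUnitalFCStarBundle A]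

include hR

/-- At a point `y` of maximal rank near `x`, `τ x (s.1 x)` is the trace of the transported value of
`s`, and the trace of `s.1 y` differs from it by at most `R` times the norm distance. Dividing by `R
+ 1` avoids requiring `0 < R`. -/
theorem tendsto_limit_functional (s : Sections A) (x : X) :
    Tendsto (fun y => τ y (s.1 y)) (𝓝[maxRankLocus A] x) (𝓝 (τ x (s.1 x))) := by
  rw [Metric.tendsto_nhds]
  intro ε hε
  have hR0 : (0 : ℝ) < R + 1 := by positivity
  have h1 := (L x).eventually_norm_sub_lt s (div_pos hε hR0)
  filter_upwards [hτ x, mem_nhdsWithin_of_mem_nhds h1, self_mem_nhdsWithin] with y ⟨hyU, hy⟩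
    ⟨_, hlt⟩ hymax
  rw [← hy, ← fdTrace_eq_of_mem hτ hymax, dist_eq_norm, ← map_sub]
  refine (norm_fdTrace_le _).trans_lt ?_
  rw [(mem_maxRankLocus_iff hR y).1 hymax]
  calc (R : ℝ) * ‖s.1 y - (L x).hom ⟨y, hyU⟩ (s.1 x)‖
      ≤ (R + 1) * ‖s.1 y - (L x).hom ⟨y, hyU⟩ (s.1 x)‖ := by
        gcongr; linarith
    _ < (R + 1) * (ε / (R + 1)) := by gcongr
    _ = ε := mul_div_cancel₀ _ hR0.ne'

/-- A function that at every point is the limit of its values along a dense set is continuous: an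
estimate along the dense set passes to the limit at nearby `z`. -/
theorem continuous_limit_functional (hd : Dense (maxRankLocus A)) (s : Sections A) :
    Continuous fun x => τ x (s.1 x) := by
  refine continuous_iff_continuousAt.2 fun x => Metric.tendsto_nhds.2 fun ε hε => ?_
  have h1 := Metric.tendsto_nhds.1 (tendsto_limit_functional hR hτ s x) (ε / 2) (half_pos hε)
  obtain ⟨V, hV, hVo, hxV⟩ := eventually_nhds_iff.1 (eventually_nhdsWithin_iff.1 h1)
  filter_upwards [hVo.mem_nhds hxV] with z hz
  have := mem_closure_iff_nhdsWithin_neBot.1 (hd z)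
  refine (le_of_tendsto ((tendsto_limit_functional hR hτ s z).dist tendsto_const_nhds) ?_).trans_lt
    (half_lt_self hε)
  filter_upwards [mem_nhdsWithin_of_mem_nhds (hVo.mem_nhds hz), self_mem_nhdsWithin] with y hy hy'
  exact (hV y hy hy').le

variable [CompactSpace X] [T2Space X] [Nonempty X]

/-- The expectation is `τ x (s.1 x) / R`; the norm bound and the value at 1 give contractivity and
idempotence. -/
theorem exists_optimal_expectation (hd : Dense (maxRankLocus A)) :
    ∃ E : Sections A →L[ℂ] Sections A,
      IsConditionalExpectation (Set.range (scalarSection A)) E ∧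
      kConstant E = (bundleRank A : ℝ≥0∞) := by
  have hmax : ∀ y ∈ maxRankLocus A, fdRank (A y) = R := fun y => (mem_maxRankLocus_iff hR y).1
  obtain ⟨y₀, hy₀⟩ : (maxRankLocus A).Nonempty := hd.nonempty
  have hRpos : 0 < R := hmax y₀ hy₀ ▸ fdRank_pos (A y₀)
  have hR0 : (R : ℂ) ≠ 0 := by exact_mod_cast hRpos.ne'
  have hRr : (0 : ℝ) < R := by exact_mod_cast hRpos
  have hone : ∀ x, τ x 1 = R := fun x => by
    obtain ⟨y, hy, φ, -, h⟩ := exists_hom_fdTrace_eq hτ hd x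
    rw [← h, map_one, fdTrace_one, hmax y hy]
  have hnorm : ∀ x a, ‖τ x a‖ ≤ R * ‖a‖ := fun x a => by
    obtain ⟨y, hy, φ, hφ, h⟩ := exists_hom_fdTrace_eq hτ hd x
    rw [← h, ← hφ, ← hmax y hy]
    exact norm_fdTrace_le _
  have hpos : ∀ x a, (‖star a * a‖ : ℂ) ≤ τ x (star a * a) := fun x a => by
    obtain ⟨y, hy, φ, hφ, h⟩ := exists_hom_fdTrace_eq hτ hd x
    rw [← h, ← hφ, map_mul, map_star]
    exact norm_le_fdTrace _
  let g : Sections A → C(X, ℂ) := fun s =>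
    ⟨fun x => (R : ℂ)⁻¹ * τ x (s.1 x),
      continuous_const.mul (continuous_limit_functional hR hτ hd s)⟩
  have hg : ∀ s x, g s x = (R : ℂ)⁻¹ * τ x (s.1 x) := fun _ _ => rfl
  let E₀ : Sections A →ₗ[ℂ] Sections A :=
    { toFun := fun s => scalarSection A (g s)
      map_add' := fun s t => Sections.ext fun x => by
        change g (s + t) x • (1 : A x) = g s x • 1 + g t x • 1
        rw [← add_smul, hg, hg, hg, ← mul_add, ← map_add]
        rfl
      map_smul' := fun c s => Sections.ext fun x => by
        change g (c • s) x • (1 : A x) = c • (g s x • 1)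
        have h1 : (c • s).1 x = c • s.1 x := rfl
        rw [smul_smul, hg, hg, h1, map_smul, smul_eq_mul, mul_left_comm] }
  have hgn : ∀ s x, ‖g s x‖ ≤ ‖s‖ := fun s x => by
    rw [hg, norm_mul, norm_inv, Complex.norm_natCast, inv_mul_le_iff₀ hRr]
    exact (hnorm x _).trans (mul_le_mul_of_nonneg_left
      (lp.norm_apply_le_norm ENNReal.top_ne_zero s.1 x) hRr.le)
  let E : Sections A →L[ℂ] Sections A := E₀.mkContinuous 1 fun s => by
    rw [one_mul]
    refine lp.norm_le_of_forall_le (norm_nonneg s) fun x => ?_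
    change ‖g s x • (1 : A x)‖ ≤ _
    rw [norm_smul, norm_one, mul_one]
    exact hgn s x
  have hE : ∀ s, E s = scalarSection A (g s) := fun _ => rfl
  have hEs : ∀ f, E (scalarSection A f) = scalarSection A f := fun f => by
    refine Sections.ext fun x => ?_
    rw [hE, scalarSection_apply, scalarSection_apply, hg, scalarSection_apply, map_smul, hone,
      smul_eq_mul, mul_left_comm, inv_mul_cancel₀ hR0, mul_one]
  have hE1 : E 1 = 1 := by
    have h1 : (1 : Sections A) = scalarSection A 1 := Sections.ext fun x => (one_smul ℂ _).symm
    rw [h1, hEs]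
  have : Nontrivial (Sections A) := ⟨0, 1, fun h => zero_ne_one (α := A y₀)
    (congrArg (evalSection A y₀) h)⟩
  refine ⟨E, ⟨fun s => by rw [hE s, hEs], ?_, ?_⟩, ?_⟩
  · ext s
    constructor
    · rintro ⟨t, rfl⟩; exact ⟨g t, (hE t).symm⟩
    · rintro ⟨f, rfl⟩; exact ⟨_, hEs f⟩
  · refine le_antisymm (E₀.mkContinuous_norm_le zero_le_one _) ?_
    have h1 := E.le_opNorm 1
    rwa [hE1, norm_one, mul_one] at h1
  · rw [hR]
    have hcast : (((R : ℕ∞)) : ℝ≥0∞) = ((R : ℝ≥0) : ℝ≥0∞) := by simp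
    rw [hcast]
    refine le_antisymm ?_ ?_
    -- For positive `a`, `R • E a` is the scalar section `τ x (a.1 x)`, which dominates the norm of
    -- `a` pointwise and hence `a`.
    · refine iInf_le_of_le (R : ℝ≥0) (iInf_le_of_le (by exact_mod_cast hRpos)
        (iInf_le_of_le (fun a ha => ?_) le_rfl))
      obtain ⟨b, hb⟩ := exists_star_mul_self_apply ha
      have hre : ∀ x, ((τ x (a.1 x)).re : ℂ) = τ x (a.1 x) ∧ ‖a.1 x‖ ≤ (τ x (a.1 x)).re := by
        intro x
        have h1 := hpos x (b.1 x)
        rw [← hb] at h1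
        exact ⟨(Complex.eq_re_of_ofReal_le h1).symm, (Complex.le_def.1 h1).1⟩
      let f : C(X, ℝ) := ⟨fun x => (τ x (a.1 x)).re,
        Complex.continuous_re.comp (continuous_limit_functional hR hτ hd a)⟩
      have h2 : ((R : ℝ≥0) : ℝ) • E a = realSection A f := by
        refine Sections.ext fun x => ?_
        change ((R : ℝ≥0) : ℝ) • (g a x • (1 : A x)) = ((τ x (a.1 x)).re : ℂ) • 1
        rw [(hre x).1, hg, ← Complex.coe_smul, smul_smul]
        simp [hR0]
      rw [h2]
      exact nonneg_realSection_sub (IsSelfAdjoint.of_nonneg ha) fun x => (hre x).2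
    -- At a point of maximal rank, a projection of trace one has expectation `1 / R`, so `K / R - p`
    -- being positive forces `K ≥ R`.
    · refine le_iInf fun K => le_iInf fun _ => le_iInf fun hK => ?_
      obtain ⟨p, hp, hp0, hp1⟩ := exists_projection_fdTrace_eq_one (A y₀)
      obtain ⟨b, hb⟩ := exists_section_apply_eq y₀ p
      obtain ⟨d, hd'⟩ := exists_star_mul_self_apply (hK _ (star_mul_self_nonneg b))
      have h1 : (star b * b).1 y₀ = p := by
        change star (b.1 y₀) * b.1 y₀ = p
        rw [hb, hp.isSelfAdjoint.star_eq, hp.isIdempotentElem.eq]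
      have h2 : ((K : ℂ) * (R : ℂ)⁻¹) • 1 - p = star (d.1 y₀) * d.1 y₀ := by
        rw [← hd' y₀]
        change _ = (K : ℝ) • (g (star b * b) y₀ • (1 : A y₀)) - (star b * b).1 y₀
        rw [h1, hg, h1, ← fdTrace_eq_of_mem hτ hy₀, hp1, mul_one, ← Complex.coe_smul, smul_smul]
      have h3 := one_le_of_smul_one_sub_eq hp hp0 h2
      have h4 : ((K : ℝ) * (R : ℝ)⁻¹ : ℝ) = ((K : ℂ) * (R : ℂ)⁻¹) := by push_cast; rfl
      have h5 : (1 : ℝ) ≤ (K : ℝ) * (R : ℝ)⁻¹ := by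
        rw [← Complex.real_le_real, h4]; exact_mod_cast h3
      rw [← div_eq_mul_inv, le_div_iff₀ hRr, one_mul] at h5
      exact_mod_cast h5

end OfLimits

/-! ### From an optimal expectation to traces and unique germs -/

section OfExpectation

variable [∀ x, Nontrivial (A x)] [hA : IsUnitalFCStarBundle A]

include hR in
-- Points of maximal rank arbitrarily near `x` attain `c`; there `c j` is the trace of the
-- transported minimal projection, hence close to the trace of `s`, which is `R * g`. Continuity of
-- `g` gives the value at `x`.
theorem isColumnSumGerm_eq_of_functional {s : Sections A} {g : C(X, ℂ)}
    (hg : ∀ y ∈ maxRankLocus A, (R : ℂ) * g y = fdTrace (A y) (s.1 y)) {x : X} {k : ℕ}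
    {m : Fin k → ℕ+} (ψ : MultiMatrix m ≃⋆ₐ[ℂ] A x) {j : Fin k}
    (hs : s.1 x = ψ (minimalProjection m j)) {c : Fin k → ℂ} (hc : IsColumnSumGerm ψ c) :
    c j = R * g x := by
  obtain ⟨L, hL⟩ := (isColumnSumGerm_iff ψ c).1 hc
  refine eq_of_forall_dist_le fun ε hε => ?_
  have hR0 : (0 : ℝ) < R + 1 := by positivity
  have h1 := L.eventually_norm_sub_lt s (div_pos (half_pos hε) hR0)
  have h2 : ∀ᶠ y in 𝓝 x, dist ((R : ℂ) * g y) (R * g x) < ε / 2 :=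
    Metric.tendsto_nhds.1 (Continuous.tendsto (by fun_prop) x) _ (half_pos hε)
  obtain ⟨y, hy, ⟨⟨hyU, hlt⟩, h2⟩, hymax⟩ := (hL.and_eventually
    (((h1.and h2).filter_mono nhdsWithin_le_nhds).and eventually_mem_nhdsWithin)).exists
  have h3 : dist (c j) ((R : ℂ) * g y) ≤ ε / 2 := by
    rw [← hy, L.colTuple_apply ψ hyU, hg y hymax, dist_comm, dist_eq_norm, ← map_sub, ← hs]
    refine (norm_fdTrace_le _).trans ?_
    rw [(mem_maxRankLocus_iff hR y).1 hymax]
    calc (R : ℝ) * ‖s.1 y - L.hom ⟨y, hyU⟩ (s.1 x)‖ ≤ (R + 1) * (ε / 2 / (R + 1)) := by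
          gcongr; linarith
      _ = ε / 2 := mul_div_cancel₀ _ hR0.ne'
  linarith [dist_triangle (c j) ((R : ℂ) * g y) (R * g x)]

variable [CompactSpace X] [T2Space X] {E : Sections A →L[ℂ] Sections A}

include hR in
-- `g` is the function with `E s = g • 1`. At `y`, `R` times this functional descends to the fibre
-- and satisfies the criterion `eq_fdTrace`.
theorem exists_functional_of_optimal
    (hE : IsConditionalExpectation (Set.range (scalarSection A)) E)
    (hK : kConstant E = (bundleRank A : ℝ≥0∞)) (s : Sections A) :
    ∃ g : C(X, ℂ), ∀ y ∈ maxRankLocus A, (R : ℂ) * g y = fdTrace (A y) (s.1 y) := by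
  have hrange : ∀ s, ∃ g, scalarSection A g = E s := fun s =>
    (Set.ext_iff.1 hE.range_eq (E s)).1 ⟨s, rfl⟩
  have hEs : ∀ f, E (scalarSection A f) = scalarSection A f := fun f => by
    obtain ⟨t, ht⟩ := (Set.ext_iff.1 hE.range_eq _).2 ⟨f, rfl⟩
    rw [← ht, hE.idempotent]
  choose g hg using hrange
  have hgx : ∀ s x, (E s).1 x = g s x • 1 := fun s x => by rw [← hg s, scalarSection_apply]
  have hinj : ∀ x, Function.Injective fun z : ℂ => z • (1 : A x) := fun x =>
    smul_left_injective ℂ one_ne_zero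
  refine ⟨g s, fun y hy => ?_⟩
  let G : Sections A →ₗ[ℂ] ℂ :=
    { toFun := fun s => g s y
      map_add' := fun s t => hinj y (by
        change g (s + t) y • (1 : A y) = (g s y + g t y) • 1
        rw [add_smul, ← hgx, ← hgx, ← hgx, map_add]
        rfl)
      map_smul' := fun c s => hinj y (by
        change g (c • s) y • (1 : A y) = (c • g s y) • 1
        rw [smul_assoc, ← hgx, ← hgx, map_smul]
        rfl) }
  have hG : ∀ s, G s = g s y := fun _ => rfl
  have hGscalar : ∀ f, G (scalarSection A f) = f y := fun f => hinj y (by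
    change g _ y • (1 : A y) = f y • 1
    rw [← hgx, hEs, scalarSection_apply])
  have hval : ∀ ε > 0, ∃ K : ℝ≥0, 1 ≤ K ∧ (K : ℝ) < R + ε ∧
      ∀ a : Sections A, 0 ≤ a → 0 ≤ (K : ℝ) • E a - a := by
    intro ε hε
    have hlt : kConstant E < ((R + ε.toNNReal : ℝ≥0) : ℝ≥0∞) := by
      rw [hK, hR]
      have : (((R : ℕ∞)) : ℝ≥0∞) = ((R : ℝ≥0) : ℝ≥0∞) := by simp
      rw [this, ENNReal.coe_lt_coe]
      exact lt_add_of_pos_right _ (Real.toNNReal_pos.2 hε)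
    simp only [kConstant, iInf_lt_iff] at hlt
    obtain ⟨K, h1, h2, h3⟩ := hlt
    refine ⟨K, h1, ?_, h2⟩
    have h4 : (K : ℝ) < ((R + ε.toNNReal : ℝ≥0) : ℝ) := by exact_mod_cast h3
    simpa [Real.coe_toNNReal _ hε.le] using h4
  have hGpos : ∀ a : Sections A, 0 ≤ a → 0 ≤ G a := by
    intro a ha
    obtain ⟨K, h1, -, h2⟩ := hval 1 one_pos
    have h3 : 0 ≤ (K : ℝ) • E a := by
      have := add_nonneg (h2 a ha) ha
      rwa [sub_add_cancel] at this
    obtain ⟨d, hd⟩ := exists_star_mul_self_apply h3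
    have h4 : star (d.1 y) * d.1 y = ((K : ℂ) * g a y) • (1 : A y) := by
      rw [← hd]
      change (K : ℝ) • (E a).1 y = _
      rw [hgx, ← Complex.coe_smul, smul_smul]
    obtain ⟨r, hr, hr'⟩ := nonneg_of_star_mul_self_eq_smul (.one _) one_ne_zero h4
    have hK0 : (0 : ℝ) < K := lt_of_lt_of_le one_pos (by exact_mod_cast h1)
    have h5 : g a y = ((r / K : ℝ) : ℂ) := by
      have : (K : ℂ) ≠ 0 := by exact_mod_cast hK0.ne'
      push_cast
      rw [eq_div_iff (by exact_mod_cast hK0.ne'), mul_comm]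
      exact hr'
    rw [hG, h5]
    exact_mod_cast div_nonneg hr hK0.le
  -- Both `t` and `-t` lie below the scalar section `‖t‖`, which `E` fixes and which vanishes at
  -- `y`.
  have hGsa : ∀ t : Sections A, IsSelfAdjoint t → t.1 y = 0 → G t = 0 := by
    intro t ht ht0
    let f : C(X, ℝ) := ⟨fun x => ‖t.1 x‖, hA.continuous_norm.comp t.2⟩
    have hf : G (realSection A f) = 0 := by
      rw [realSection, hGscalar]
      change ((‖t.1 y‖ : ℝ) : ℂ) = 0
      simp [ht0]
    have h1 := hGpos _ (nonneg_realSection_sub ht (f := f) fun x => le_rfl)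
    have h2 := hGpos _ (nonneg_realSection_sub (s := -t) ht.neg (f := f)
      fun x => (norm_neg (t.1 x)).le)
    rw [map_sub, hf, zero_sub] at h1 h2
    rw [map_neg, neg_neg] at h2
    exact le_antisymm (neg_nonneg.1 h1) h2
  have hG0 : ∀ t : Sections A, t.1 y = 0 → G t = 0 := by
    intro t ht
    rw [← realPart_add_I_smul_imaginaryPart t, map_add, map_smul, hGsa _ (realPart t).2,
      hGsa _ (imaginaryPart t).2, smul_zero, add_zero]
    · rw [imaginaryPart_apply_coe]
      change -Complex.I • ((2⁻¹ : ℝ) • (t.1 y - star (t.1 y))) = 0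
      simp [ht]
    · rw [realPart_apply_coe]
      change (2⁻¹ : ℝ) • (t.1 y + star (t.1 y)) = 0
      simp [ht]
  -- Positivity of `K • E - id` on `star b * b`, read at `y`, bounds `K * G` below by 1 for `K < R +
  -- ε`; then `ε` tends to zero.
  have hGproj : ∀ (b : Sections A), IsStarProjection (b.1 y) → b.1 y ≠ 0 →
      1 ≤ (R : ℂ) * G (star b * b) := by
    intro b hp hp0
    have hnn := hGpos _ (star_mul_self_nonneg b)
    obtain ⟨r, hr⟩ : ∃ r : ℝ, G (star b * b) = r := ⟨_, Complex.eq_re_of_ofReal_le hnn⟩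
    have hr0 : 0 ≤ r := by rw [hr] at hnn; exact_mod_cast hnn
    rw [hr]
    have key : ∀ ε > 0, 1 ≤ (R + ε) * r := by
      intro ε hε
      obtain ⟨K, -, h1, h2⟩ := hval ε hε
      obtain ⟨d, hd⟩ := exists_star_mul_self_apply (h2 _ (star_mul_self_nonneg b))
      have h3 : ((K : ℂ) * G (star b * b)) • (1 : A y) - b.1 y = star (d.1 y) * d.1 y := by
        rw [← hd]
        change _ = (K : ℝ) • (E (star b * b)).1 y - star (b.1 y) * b.1 y
        rw [hp.isSelfAdjoint.star_eq, hp.isIdempotentElem.eq, hgx, ← Complex.coe_smul, smul_smul]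
        rfl
      have h4 := one_le_of_smul_one_sub_eq hp hp0 h3
      rw [hr] at h4
      have h5 : (1 : ℝ) ≤ K * r := by exact_mod_cast h4
      exact h5.trans (mul_le_mul_of_nonneg_right h1.le hr0)
    have hlim : Tendsto (fun ε : ℝ => (R + ε) * r) (𝓝[>] 0) (𝓝 ((R + 0) * r)) :=
      (Continuous.tendsto (by fun_prop) 0).mono_left nhdsWithin_le_nhds
    have h1 := ge_of_tendsto hlim (eventually_mem_nhdsWithin.mono fun ε hε => key ε hε)
    rw [add_zero] at h1
    exact_mod_cast h1
  -- As `G` kills the sections vanishing at `y`, composing it with any linear right inverse of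
  -- evaluation gives the induced functional on the fibre.
  let ev : Sections A →ₗ[ℂ] A y :=
    { toFun := fun s => s.1 y, map_add' := fun _ _ => rfl, map_smul' := fun _ _ => rfl }
  obtain ⟨ρ, hρ⟩ := ev.exists_rightInverse_of_surjective
    (LinearMap.range_eq_top.2 fun b => exists_section_apply_eq y b)
  have hρy : ∀ a, (ρ a).1 y = a := fun a => LinearMap.congr_fun hρ a
  have hGρ : ∀ t : Sections A, G (ρ (t.1 y)) = G t := fun t => by
    rw [← sub_eq_zero, ← map_sub]
    apply hG0
    change (ρ (t.1 y)).1 y - t.1 y = 0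
    rw [hρy, sub_self]
  have h := eq_fdTrace (B := A y) (f := (R : ℂ) • (G ∘ₗ ρ)) ?_ (fun p hp hp0 => ?_) (s.1 y)
  · rw [← h]
    change _ = (R : ℂ) * G (ρ (s.1 y))
    rw [hGρ]
    rfl
  · change (R : ℂ) * G (ρ 1) = _
    have h1 : G (ρ 1) = 1 := (hGρ 1).trans (by
      have h1 : (1 : Sections A) = scalarSection A 1 := Sections.ext fun x => (one_smul ℂ _).symm
      rw [h1, hGscalar]
      rfl)
    rw [h1, mul_one, (mem_maxRankLocus_iff hR y).1 hy]
  · change 1 ≤ (R : ℂ) * G (ρ p)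
    have h1 := hGproj (ρ p) (by rwa [hρy]) (by rwa [hρy])
    rwa [← hGρ, show (star (ρ p) * ρ p).1 y = p by
      change star ((ρ p).1 y) * (ρ p).1 y = p
      rw [hρy, hp.isSelfAdjoint.star_eq, hp.isIdempotentElem.eq]] at h1

end OfExpectation

end Expectations
end

theorem mainTheorem4 {X : Type*} [TopologicalSpace X] [CompactSpace X] [T2Space X] [Nonempty X]
    (A : X → Type*) [∀ x, CStarAlgebra (A x)] [∀ x, Nontrivial (A x)] [TopologicalSpace (Tot A)]
    [IsUnitalFCStarBundle A] (hsub : IsSubhomogeneous A) :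
    IsOpen (maxRankLocus A) ∧
    (Dense (maxRankLocus A) →
      ((∃ E : Sections A →L[ℂ] Sections A,
          IsConditionalExpectation (Set.range (scalarSection A)) E ∧
          kConstant E = (bundleRank A : ℝ≥0∞)) ↔
        ∀ (x : X) (k : ℕ) (m : Fin k → ℕ+) (ψ : MultiMatrix m ≃⋆ₐ[ℂ] A x),
          ∃! c : Fin k → ℂ, IsColumnSumGerm ψ c)) := by
  have hfd : ∀ x, FiniteDimensional ℂ (A x) := fun x => (hsub.choose_spec x).1
  obtain ⟨R, hR⟩ := exists_bundleRank_eq hsub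
  refine ⟨isOpen_maxRankLocus hR, fun hd => ⟨?_, fun h => ?_⟩⟩
  · rintro ⟨E, hE, hK⟩ x k m ψ
    obtain ⟨c, hc⟩ := exists_isColumnSumGerm hR hd ψ
    refine ⟨c, hc, fun c' hc' => funext fun j => ?_⟩
    obtain ⟨s, hs⟩ := exists_section_apply_eq x (ψ (minimalProjection m j))
    obtain ⟨g, hg⟩ := exists_functional_of_optimal hR hE hK s
    rw [isColumnSumGerm_eq_of_functional hR hg ψ hs hc,
      isColumnSumGerm_eq_of_functional hR hg ψ hs hc']
  · choose τ L hτ using fun x => exists_limit_functional hR (h x)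
    exact exists_optimal_expectation hR hτ hd
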